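/- **Setting.** A *modal bi-Heyting algebra* $\mathbf A$ is a bi-Heyting algebra (with $u\wedge v\le w$ iff $u\le v\to w$, and $u-v\le w$ iff $u\le v\vee w$) with operations $\Box$ and $\Diamond$ preserving finite meets and finite joins, respectively. Its canonical extension $\mathbf A^\delta$ is the completely distributive complete lattice extending $\mathbf A$ in which $\mathbf A$ is dense (every element is a join of meets and a meet of joins of elements of $A$) and compact ($\bigwedge S\le\bigvee T$ with $S,T\subseteq A$ implies $\bigwedge S'\le\bigvee T'$ for some finite $S'\subseteq S$, $T'\subseteq T$); it carries the residuals $\to$ and $-$, the extensions $\Diamond^\sigma$ and $\Box^\pi$, the right adjoint $\blacksquare$ of $\Diamond$ and the left adjoint $\blacklozenge$ of $\Box$. $J^\infty(\mathbf A^\delta)$ and $M^\infty(\mathbf A^\delta)$ are the sets of completely join-, resp. meet-irreducible elements. $\mathcal L_1$ (resp. $\mathcal L_2$) is the language of modal bi-Heyting algebras with fixed point binders $\mu X.t,\nu X.t$ (resp. $\mu_2X.t,\nu_2X.t$), for $t$ positive in $X$. In $\mathbf A$, $\mu X.t(X)=\bigwedge\{a\in A\mid t(a)\le a\}$, while $\mu_2X.t(X)=\bigvee_\alpha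 t^\alpha(\bot)$ is the join of the transfinite approximants, if these meets and joins exist; $\nu$ and $\nu_2$ are defined dually. $\mathbf A$ is a *mu-algebra of the first kind* (*second kind*) if all $\mathcal L_1$-terms ($\mathcal L_2$-terms) are everywhere defined on $\mathbf A$. $\mathcal L_*$ has instead binders $\mu^*,\nu^*$, and $\mathcal L^+_*$ has in addition $\blacksquare$, $\blacklozenge$, nominals and co-nominals. They are interpreted in $\mathbf A^\delta$, with $\mu^*X.t(X)=\bigwedge\{a\in A\mid t(a)\le a\}$ and $\nu^*X.t(X)=\bigvee\{a\in A\mid a\le t(a)\}$. $\varphi^*$ is $\varphi$ with $\mu,\nu$ replaced by $\mu^*,\nu^*$. An *admissible assignment* sends propositional variables into $A$, nominals into $J^\infty(\mathbf A^\delta)$ and co-nominals into $M^\infty(\mathbf A^\delta)$. An inequality or quasi-inequality $\varphi_1\le\psi_1\,\&\cdots\&\,\varphi_k\le\psi_k\Rightarrow\varphi\le\psi$ between sentences is *admissibly valid* on $\mathbf A^\delta$ if it is true under all admissible assignments. *Syntactically open* formulas $\varphi$ and *syntactically closed* formulas $\psi$ of $\mathcal L^+_*$ are given by $$\varphi::=\bot\mid\top\mid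 p\mid X\mid\mathbf m\mid\varphi\wedge\varphi\mid\varphi\vee\varphi\mid\psi\to\varphi\mid\varphi-\psi\mid\Box\varphi\mid\Diamond\varphi\mid\blacksquare\varphi\mid\nu^*X.\varphi,$$ $$\psi::=\bot\mid\top\mid p\mid X\mid\mathbf i\mid\psi\wedge\psi\mid\psi\vee\psi\mid\varphi\to\psi\mid\psi-\varphi\mid\Box\psi\mid\Diamond\psi\mid\blacklozenge\psi\mid\mu^*X.\psi.$$ **Rules.** The *$\mu^*$-ALBA rules* replace inequalities in the antecedent of a quasi-inequality (a conjunction, taken up to associativity, commutativity and idempotence of $\&$) as follows; nominals and co-nominals on the right that are not on the left must be fresh. * Residuation: $\chi-\psi\le\varphi\leadsto\chi\le\psi\vee\varphi$; $\ \varphi\le\chi\to\psi\leadsto\varphi\wedge\chi\le\psi$; $\ \chi\wedge\psi\le\varphi\leadsto\chi\le\psi\to\varphi$ or $\psi\le\chi\to\varphi$; $\ \varphi\le\chi\vee\psi\leadsto\varphi-\chi\le\psi$ or $\varphi-\psi\le\chi$. * Adjunction: $\varphi\vee\chi\le\psi\leadsto\varphi\le\psi\,\&\,\chi\le\psi$;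 $\ \psi\le\varphi\wedge\chi\leadsto\psi\le\varphi\,\&\,\psi\le\chi$; $\ \Diamond\varphi\le\psi\leadsto\varphi\le\blacksquare\psi$; $\ \varphi\le\Box\psi\leadsto\blacklozenge\varphi\le\psi$. * Approximation: $\Box\psi\le\mathbf m\leadsto\Box\mathbf n\le\mathbf m\,\&\,\psi\le\mathbf n$; $\ \mathbf j\le\Diamond\psi\leadsto\mathbf j\le\Diamond\mathbf i\,\&\,\mathbf i\le\psi$; $\ \chi\to\varphi\le\mathbf m\leadsto\mathbf j\to\mathbf n\le\mathbf m\,\&\,\mathbf j\le\chi\,\&\,\varphi\le\mathbf n$; $\ \mathbf i\le\chi-\varphi\leadsto\mathbf i\le\mathbf j-\mathbf n\,\&\,\mathbf j\le\chi\,\&\,\varphi\le\mathbf n$. * Right Ackermann rule: if $p$ does not occur in the rest of the quasi-inequality, all $\alpha_i$ are $p$-free and syntactically closed, all $\beta_j$ are positive in $p$ and syntactically closed, and all $\gamma_j$ are negative in $p$ and syntactically open, then $\&_i\,\alpha_i\le p\ \&\ \&_j\,\beta_j(p)\le\gamma_j(p)$ is replaced by $\&_j\,\beta_j(\bigvee_i\alpha_i/p)\le\gamma_j(\bigvee_i\alpha_i/p)$.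 * Left Ackermann rule: if $p$ does not occur in the rest of the quasi-inequality, all $\alpha_i$ are $p$-free and syntactically open, all $\beta_j$ are positive in $p$ and syntactically open, and all $\gamma_j$ are negative in $p$ and syntactically closed, then $\&_i\,p\le\alpha_i\ \&\ \&_j\,\gamma_j(p)\le\beta_j(p)$ is replaced by $\&_j\,\gamma_j(\bigwedge_i\alpha_i/p)\le\beta_j(\bigwedge_i\alpha_i/p)$. * Fixed point approximation rules. Let $\tau\in\{1,\partial\}^n$, let $\psi(\overline x,X)$ be an $\mathcal L_*$-formula positive in $X$, without propositional variables and with free variables among $\overline x,X$, whose term function on $\mathbf A^\delta$ preserves all joins as a map $(\mathbf A^\delta)^\tau\times\mathbf A^\delta\to\mathbf A^\delta$, and let $\overline\varphi$ be an $n$-tuple of $\mathcal L_*$-sentences. A quasi-inequality with the inequality $\mathbf i\le\mu^*X.\psi(\overline\varphi/\overline x,X)$ in its antecedent is replaced by $n$ quasi-inequalities: in the $k$-th of them, that inequality is replaced by $\mathbf i\le\mu^*X.\psi(\overline{\mathbf j}_k/\overline x,X)\ \&\ \mathbf j^{\tau_k}\le^{\tau_k}\varphi_k$, where $\mathbf j^{\tau_k}$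 is a fresh nominal if $\tau_k=1$ and a fresh co-nominal if $\tau_k=\partial$, the relation $\le^1$ is $\le$ and $\le^\partial$ is $\ge$, and $\overline{\mathbf j}_k$ has $\mathbf j^{\tau_k}$ in coordinate $k$ and, in every coordinate $l\ne k$, $\bot$ if $\tau_l=1$ and $\top$ if $\tau_l=\partial$. Dually for an inequality $\nu^*X.\varphi(\overline\psi/\overline x,X)\le\mathbf m$, with the term function of $\varphi$ preserving all meets. **Statement.** Let $\varphi\le\psi$ be an inequality between $\mathcal L_1$-sentences, let $\mathbf i$ be a nominal and $\mathbf m$ a co-nominal, and let $\mathsf{FA}(\varphi^*\le\psi^*)$ be the quasi-inequality $\mathbf i\le\varphi^*\ \&\ \psi^*\le\mathbf m\Rightarrow\mathbf i\le\mathbf m$. 1. If $\mathbf A$ is a mu-algebra of the second kind, and a set $\mathcal Q$ of quasi-inequalities is obtained from $\{\mathsf{FA}(\varphi^*\le\psi^*)\}$ by finitely many applications of $\mu^*$-ALBA rules to members of the set, then $\varphi^*\le\psi^*$ is admissibly valid on $\mathbf A^\delta$ if and only if every member of $\mathcal Q$ is admissibly valid on $\mathbf A^\delta$. 2. If $\mathbf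 A$ is a mu-algebra of the first kind, and a quasi-inequality $\mathsf Q$ is obtained from $\mathsf{FA}(\varphi^*\le\psi^*)$ by finitely many applications of $\mu^*$-ALBA rules other than the fixed point approximation rules, then $\varphi^*\le\psi^*$ is admissibly valid on $\mathbf A^\delta$ if and only if $\mathsf Q$ is. -/

import Mathlib

universe u v

namespace MuALBA

/-! ## Algebras -/

/-- Modal bi-Heyting algebras. In Mathlib's notation the implication is `a ⇨ b` and the
subtraction is `a \ b`, with `a \ b ≤ c ↔ a ≤ b ⊔ c`. -/
class ModalBiheytingAlgebra (A : Type u) extends BiheytingAlgebra A where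
  box : A → A
  dia : A → A
  box_top : box ⊤ = ⊤
  box_inf : ∀ a b, box (a ⊓ b) = box a ⊓ box b
  dia_bot : dia ⊥ = ⊥
  dia_sup : ∀ a b, dia (a ⊔ b) = dia a ⊔ dia b

/-- Completely join-irreducible elements of a complete lattice. -/
def IsCJI {C : Type v} [CompleteLattice C] (j : C) : Prop :=
  ∀ S : Set C, j = sSup S → ∃ x ∈ S, j = x

/-- Completely meet-irreducible elements of a complete lattice. -/
def IsCMI {C : Type v} [CompleteLattice C] (m : C) : Prop :=
  ∀ S : Set C, m = sInf S → ∃ x ∈ S, m = x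

section CanonicalExtension

variable {A : Type u} [ModalBiheytingAlgebra A] {C : Type v} [CompletelyDistribLattice C]

/-- Closed elements: meets of elements of `A`. -/
def IsClosedElem (e : BoundedLatticeHom A C) (c : C) : Prop :=
  ∃ S : Set A, c = sInf (e '' S)

/-- Open elements: joins of elements of `A`. -/
def IsOpenElem (e : BoundedLatticeHom A C) (c : C) : Prop :=
  ∃ S : Set A, c = sSup (e '' S)

/-- The bounded lattice homomorphism `e : A → C` exhibits `C` as the canonical extension of `A`:
it is an embedding into a complete lattice in which the image of `A` is dense and compact. -/
structure IsCanonicalExtension (e : BoundedLatticeHom A C) : Prop where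
  injective : Function.Injective e
  dense_join : ∀ c : C, ∃ K : Set C, (∀ k ∈ K, IsClosedElem e k) ∧ c = sSup K
  dense_meet : ∀ c : C, ∃ U : Set C, (∀ w ∈ U, IsOpenElem e w) ∧ c = sInf U
  compact : ∀ S T : Set A, sInf (e '' S) ≤ sSup (e '' T) →
    ∃ S' T' : Finset A, (S' : Set A) ⊆ S ∧ (T' : Set A) ⊆ T ∧ S'.inf id ≤ T'.sup id

/-- The `σ`-extension of a map `f : A → A`. -/
def sigmaExt (e : BoundedLatticeHom A C) (f : A → A) (c : C) : C :=
  sSup {x | ∃ k w, IsClosedElem e k ∧ IsOpenElem e w ∧ k ≤ c ∧ c ≤ w ∧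
    x = sInf {y | ∃ a : A, k ≤ e a ∧ e a ≤ w ∧ y = e (f a)}}

/-- The `π`-extension of a map `f : A → A`. -/
def piExt (e : BoundedLatticeHom A C) (f : A → A) (c : C) : C :=
  sInf {x | ∃ k w, IsClosedElem e k ∧ IsOpenElem e w ∧ k ≤ c ∧ c ≤ w ∧
    x = sSup {y | ∃ a : A, k ≤ e a ∧ e a ≤ w ∧ y = e (f a)}}

/-- The diamond of the canonical extension. -/
def diaC (e : BoundedLatticeHom A C) : C → C := sigmaExt e ModalBiheytingAlgebra.dia

/-- The box of the canonical extension. -/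
def boxC (e : BoundedLatticeHom A C) : C → C := piExt e ModalBiheytingAlgebra.box

/-- The black box: the right adjoint of the diamond on the canonical extension. -/
def bboxC (e : BoundedLatticeHom A C) (b : C) : C := sSup {a | diaC e a ≤ b}

/-- The black diamond: the left adjoint of the box on the canonical extension. -/
def bdiaC (e : BoundedLatticeHom A C) (a : C) : C := sInf {b | a ≤ boxC e b}

end CanonicalExtension

/-! ## Languages

Formulas are well scoped: the free fixed point (or placeholder) variables of a formula of type
`Term n` or `XTerm n` are indexed by `Fin n`, and a binder binds the variable with index `0`.
Formulas of type `Term 0` and `XTerm 0` are the sentences. Propositional variables, nominals and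
co-nominals are named by natural numbers. -/

/-- Raw formulas of the language of modal bi-Heyting algebras with fixed point binders. Read with
the binders `μ, ν` they are formulas of `𝓛₁`, and with `μ₂, ν₂` formulas of `𝓛₂`. -/
inductive Term : ℕ → Type
  | bot {n : ℕ} : Term n
  | top {n : ℕ} : Term n
  | prop {n : ℕ} (p : ℕ) : Term n
  | fvar {n : ℕ} (x : Fin n) : Term n
  | conj {n : ℕ} (s t : Term n) : Term n
  | disj {n : ℕ} (s t : Term n) : Term n
  | imp {n : ℕ} (s t : Term n) : Term n
  | sub {n : ℕ} (s t : Term n) : Term n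
  | dia {n : ℕ} (t : Term n) : Term n
  | box {n : ℕ} (t : Term n) : Term n
  | mu {n : ℕ} (t : Term (n + 1)) : Term n
  | nu {n : ℕ} (t : Term (n + 1)) : Term n

/-- Raw formulas of the extended language `𝓛⁺_*`, with nominals, co-nominals, the black box, the
black diamond, and the binders `μ*` and `ν*`. -/
inductive XTerm : ℕ → Type
  | bot {n : ℕ} : XTerm n
  | top {n : ℕ} : XTerm n
  | prop {n : ℕ} (p : ℕ) : XTerm n
  | nom {n : ℕ} (i : ℕ) : XTerm n
  | conom {n : ℕ} (m : ℕ) : XTerm n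
  | fvar {n : ℕ} (x : Fin n) : XTerm n
  | conj {n : ℕ} (s t : XTerm n) : XTerm n
  | disj {n : ℕ} (s t : XTerm n) : XTerm n
  | imp {n : ℕ} (s t : XTerm n) : XTerm n
  | sub {n : ℕ} (s t : XTerm n) : XTerm n
  | dia {n : ℕ} (t : XTerm n) : XTerm n
  | box {n : ℕ} (t : XTerm n) : XTerm n
  | bbox {n : ℕ} (t : XTerm n) : XTerm n
  | bdia {n : ℕ} (t : XTerm n) : XTerm n
  | mu {n : ℕ} (t : XTerm (n + 1)) : XTerm n
  | nu {n : ℕ} (t : XTerm (n + 1)) : XTerm n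

namespace Term

/-- `SignedVar s x t`: in the positive generation tree of `t`, all nodes labelled with the free
fixed point variable `x` are signed `s` (`true` for `+`, `false` for `-`). -/
def SignedVar : {n : ℕ} → Bool → Fin n → Term n → Prop
  | _, _, _, bot => True
  | _, _, _, top => True
  | _, _, _, prop _ => True
  | _, s, x, fvar y => y = x → s = true
  | _, s, x, conj t t' => SignedVar s x t ∧ SignedVar s x t'
  | _, s, x, disj t t' => SignedVar s x t ∧ SignedVar s x t'
  | _, s, x, imp t t' => SignedVar (!s) x t ∧ SignedVar s x t'
  | _, s, x, sub t t' => SignedVar s x t ∧ SignedVar (!s) x t'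
  | _, s, x, dia t => SignedVar s x t
  | _, s, x, box t => SignedVar s x t
  | _, s, x, mu t => SignedVar s x.succ t
  | _, s, x, nu t => SignedVar s x.succ t

/-- The formation condition of the languages with binders: `μX.t` and `νX.t` are formed only
when `t` is positive in `X`. -/
def WF : {n : ℕ} → Term n → Prop
  | _, bot => True
  | _, top => True
  | _, prop _ => True
  | _, fvar _ => True
  | _, conj t t' => WF t ∧ WF t'
  | _, disj t t' => WF t ∧ WF t'
  | _, imp t t' => WF t ∧ WF t'
  | _, sub t t' => WF t ∧ WF t'
  | _, dia t => WF t
  | _, box t => WF t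
  | _, mu t => SignedVar true 0 t ∧ WF t
  | _, nu t => SignedVar true 0 t ∧ WF t

/-- The propositional variables occurring in a formula. -/
def props : {n : ℕ} → Term n → Set ℕ
  | _, bot => ∅
  | _, top => ∅
  | _, prop p => {p}
  | _, fvar _ => ∅
  | _, conj t t' => props t ∪ props t'
  | _, disj t t' => props t ∪ props t'
  | _, imp t t' => props t ∪ props t'
  | _, sub t t' => props t ∪ props t'
  | _, dia t => props t
  | _, box t => props t
  | _, mu t => props t
  | _, nu t => props t

/-- `t ↦ t*`: replace `μ` and `ν` by `μ*` and `ν*`. The formulas in the image are those of `𝓛_*`. -/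
def star : {n : ℕ} → Term n → XTerm n
  | _, bot => .bot
  | _, top => .top
  | _, prop p => .prop p
  | _, fvar x => .fvar x
  | _, conj t t' => .conj (star t) (star t')
  | _, disj t t' => .disj (star t) (star t')
  | _, imp t t' => .imp (star t) (star t')
  | _, sub t t' => .sub (star t) (star t')
  | _, dia t => .dia (star t)
  | _, box t => .box (star t)
  | _, mu t => .mu (star t)
  | _, nu t => .nu (star t)

section Interpretation

variable {A : Type u} [ModalBiheytingAlgebra A]

/-- `Denotes₁ v t ρ a`: read as a formula of `𝓛₁`, `t` is defined in `A` and has the value `a`,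
when the propositional variables take the values `v` and the free variables the values `ρ`. -/
def Denotes₁ (v : ℕ → A) : {n : ℕ} → Term n → (Fin n → A) → A → Prop
  | _, bot, _, a => a = ⊥
  | _, top, _, a => a = ⊤
  | _, prop p, _, a => a = v p
  | _, fvar x, ρ, a => a = ρ x
  | _, conj t t', ρ, a => ∃ b c, Denotes₁ v t ρ b ∧ Denotes₁ v t' ρ c ∧ a = b ⊓ c
  | _, disj t t', ρ, a => ∃ b c, Denotes₁ v t ρ b ∧ Denotes₁ v t' ρ c ∧ a = b ⊔ c
  | _, imp t t', ρ, a => ∃ b c, Denotes₁ v t ρ b ∧ Denotes₁ v t' ρ c ∧ a = b ⇨ c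
  | _, sub t t', ρ, a => ∃ b c, Denotes₁ v t ρ b ∧ Denotes₁ v t' ρ c ∧ a = b \ c
  | _, dia t, ρ, a => ∃ b, Denotes₁ v t ρ b ∧ a = ModalBiheytingAlgebra.dia b
  | _, box t, ρ, a => ∃ b, Denotes₁ v t ρ b ∧ a = ModalBiheytingAlgebra.box b
  | _, mu t, ρ, a => IsGLB {b | ∃ c, Denotes₁ v t (Fin.cons b ρ) c ∧ c ≤ b} a
  | _, nu t, ρ, a => IsLUB {b | ∃ c, Denotes₁ v t (Fin.cons b ρ) c ∧ b ≤ c} a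

/-- `Denotes₂ v t ρ a`: read as a formula of `𝓛₂`, `t` is defined in `A` and has the value `a`,
when the propositional variables take the values `v` and the free variables the values `ρ`. In the
clauses for the binders, `s α` is the `α`-th approximant. -/
def Denotes₂ (v : ℕ → A) : {n : ℕ} → Term n → (Fin n → A) → A → Prop
  | _, bot, _, a => a = ⊥
  | _, top, _, a => a = ⊤
  | _, prop p, _, a => a = v p
  | _, fvar x, ρ, a => a = ρ x
  | _, conj t t', ρ, a => ∃ b c, Denotes₂ v t ρ b ∧ Denotes₂ v t' ρ c ∧ a = b ⊓ c
  | _, disj t t', ρ, a => ∃ b c, Denotes₂ v t ρ b ∧ Denotes₂ v t' ρ c ∧ a = b ⊔ c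
  | _, imp t t', ρ, a => ∃ b c, Denotes₂ v t ρ b ∧ Denotes₂ v t' ρ c ∧ a = b ⇨ c
  | _, sub t t', ρ, a => ∃ b c, Denotes₂ v t ρ b ∧ Denotes₂ v t' ρ c ∧ a = b \ c
  | _, dia t, ρ, a => ∃ b, Denotes₂ v t ρ b ∧ a = ModalBiheytingAlgebra.dia b
  | _, box t, ρ, a => ∃ b, Denotes₂ v t ρ b ∧ a = ModalBiheytingAlgebra.box b
  | _, mu t, ρ, a => ∃ s : Ordinal.{u} → A, s 0 = ⊥ ∧
      (∀ α, Denotes₂ v t (Fin.cons (s α) ρ) (s (Order.succ α))) ∧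
      (∀ l, Order.IsSuccLimit l → IsLUB (s '' Set.Iio l) (s l)) ∧ IsLUB (Set.range s) a
  | _, nu t, ρ, a => ∃ s : Ordinal.{u} → A, s 0 = ⊤ ∧
      (∀ α, Denotes₂ v t (Fin.cons (s α) ρ) (s (Order.succ α))) ∧
      (∀ l, Order.IsSuccLimit l → IsGLB (s '' Set.Iio l) (s l)) ∧ IsGLB (Set.range s) a

end Interpretation

end Term

/-- Mu-algebras of the first kind: every formula of `𝓛₁` is everywhere defined. -/
def IsFirstKind (A : Type u) [ModalBiheytingAlgebra A] : Prop :=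
  ∀ (n : ℕ) (t : Term n), t.WF → ∀ (v : ℕ → A) (ρ : Fin n → A), ∃ a, t.Denotes₁ v ρ a

/-- Mu-algebras of the second kind: every formula of `𝓛₂` is everywhere defined. -/
def IsSecondKind (A : Type u) [ModalBiheytingAlgebra A] : Prop :=
  ∀ (n : ℕ) (t : Term n), t.WF → ∀ (v : ℕ → A) (ρ : Fin n → A), ∃ a, t.Denotes₂ v ρ a

namespace XTerm

/-- The propositional variables occurring in a formula. -/
def props : {n : ℕ} → XTerm n → Set ℕ
  | _, bot => ∅
  | _, top => ∅
  | _, prop p => {p}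
  | _, nom _ => ∅
  | _, conom _ => ∅
  | _, fvar _ => ∅
  | _, conj t t' => props t ∪ props t'
  | _, disj t t' => props t ∪ props t'
  | _, imp t t' => props t ∪ props t'
  | _, sub t t' => props t ∪ props t'
  | _, dia t => props t
  | _, box t => props t
  | _, bbox t => props t
  | _, bdia t => props t
  | _, mu t => props t
  | _, nu t => props t

/-- The nominals occurring in a formula. -/
def noms : {n : ℕ} → XTerm n → Set ℕ
  | _, bot => ∅
  | _, top => ∅
  | _, prop _ => ∅
  | _, nom i => {i}
  | _, conom _ => ∅
  | _, fvar _ => ∅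
  | _, conj t t' => noms t ∪ noms t'
  | _, disj t t' => noms t ∪ noms t'
  | _, imp t t' => noms t ∪ noms t'
  | _, sub t t' => noms t ∪ noms t'
  | _, dia t => noms t
  | _, box t => noms t
  | _, bbox t => noms t
  | _, bdia t => noms t
  | _, mu t => noms t
  | _, nu t => noms t

/-- The co-nominals occurring in a formula. -/
def conoms : {n : ℕ} → XTerm n → Set ℕ
  | _, bot => ∅
  | _, top => ∅
  | _, prop _ => ∅
  | _, nom _ => ∅
  | _, conom m => {m}
  | _, fvar _ => ∅
  | _, conj t t' => conoms t ∪ conoms t'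
  | _, disj t t' => conoms t ∪ conoms t'
  | _, imp t t' => conoms t ∪ conoms t'
  | _, sub t t' => conoms t ∪ conoms t'
  | _, dia t => conoms t
  | _, box t => conoms t
  | _, bbox t => conoms t
  | _, bdia t => conoms t
  | _, mu t => conoms t
  | _, nu t => conoms t

/-- `SignedProp s p t`: in the positive generation tree of `t`, all nodes labelled with the
propositional variable `p` are signed `s` (`true` for `+`, `false` for `-`). -/
def SignedProp : {n : ℕ} → Bool → ℕ → XTerm n → Prop
  | _, _, _, bot => True
  | _, _, _, top => True
  | _, s, p, prop q => q = p → s = true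
  | _, _, _, nom _ => True
  | _, _, _, conom _ => True
  | _, _, _, fvar _ => True
  | _, s, p, conj t t' => SignedProp s p t ∧ SignedProp s p t'
  | _, s, p, disj t t' => SignedProp s p t ∧ SignedProp s p t'
  | _, s, p, imp t t' => SignedProp (!s) p t ∧ SignedProp s p t'
  | _, s, p, sub t t' => SignedProp s p t ∧ SignedProp (!s) p t'
  | _, s, p, dia t => SignedProp s p t
  | _, s, p, box t => SignedProp s p t
  | _, s, p, bbox t => SignedProp s p t
  | _, s, p, bdia t => SignedProp s p t
  | _, s, p, mu t => SignedProp s p t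
  | _, s, p, nu t => SignedProp s p t

/-- `t` is positive in the propositional variable `p`. -/
def PosIn {n : ℕ} (p : ℕ) (t : XTerm n) : Prop := SignedProp true p t

/-- `t` is negative in the propositional variable `p`. -/
def NegIn {n : ℕ} (p : ℕ) (t : XTerm n) : Prop := SignedProp false p t

mutual

/-- Syntactically open formulas. -/
def SynOpen : {n : ℕ} → XTerm n → Prop
  | _, bot => True
  | _, top => True
  | _, prop _ => True
  | _, nom _ => False
  | _, conom _ => True
  | _, fvar _ => True
  | _, conj t t' => SynOpen t ∧ SynOpen t'
  | _, disj t t' => SynOpen t ∧ SynOpen t'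
  | _, imp t t' => SynClosed t ∧ SynOpen t'
  | _, sub t t' => SynOpen t ∧ SynClosed t'
  | _, dia t => SynOpen t
  | _, box t => SynOpen t
  | _, bbox t => SynOpen t
  | _, bdia _ => False
  | _, mu _ => False
  | _, nu t => SynOpen t

/-- Syntactically closed formulas. -/
def SynClosed : {n : ℕ} → XTerm n → Prop
  | _, bot => True
  | _, top => True
  | _, prop _ => True
  | _, nom _ => True
  | _, conom _ => False
  | _, fvar _ => True
  | _, conj t t' => SynClosed t ∧ SynClosed t'
  | _, disj t t' => SynClosed t ∧ SynClosed t'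
  | _, imp t t' => SynOpen t ∧ SynClosed t'
  | _, sub t t' => SynClosed t ∧ SynOpen t'
  | _, dia t => SynClosed t
  | _, box t => SynClosed t
  | _, bbox _ => False
  | _, bdia t => SynClosed t
  | _, mu t => SynClosed t
  | _, nu _ => False

end

/-- Renaming of free fixed point variables. -/
def rename : {n m : ℕ} → XTerm n → (Fin n → Fin m) → XTerm m
  | _, _, bot, _ => bot
  | _, _, top, _ => top
  | _, _, prop p, _ => prop p
  | _, _, nom i, _ => nom i
  | _, _, conom i, _ => conom i
  | _, _, fvar x, f => fvar (f x)
  | _, _, conj t t', f => conj (rename t f) (rename t' f)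
  | _, _, disj t t', f => disj (rename t f) (rename t' f)
  | _, _, imp t t', f => imp (rename t f) (rename t' f)
  | _, _, sub t t', f => sub (rename t f) (rename t' f)
  | _, _, dia t, f => dia (rename t f)
  | _, _, box t, f => box (rename t f)
  | _, _, bbox t, f => bbox (rename t f)
  | _, _, bdia t, f => bdia (rename t f)
  | _, _, mu t, f => mu (rename t (Fin.cons 0 fun k => (f k).succ))
  | _, _, nu t, f => nu (rename t (Fin.cons 0 fun k => (f k).succ))

/-- Simultaneous (capture-avoiding) substitution for the free fixed point or placeholder
variables. -/
def subst : {n m : ℕ} → XTerm n → (Fin n → XTerm m) → XTerm m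
  | _, _, bot, _ => bot
  | _, _, top, _ => top
  | _, _, prop p, _ => prop p
  | _, _, nom i, _ => nom i
  | _, _, conom i, _ => conom i
  | _, _, fvar x, f => f x
  | _, _, conj t t', f => conj (subst t f) (subst t' f)
  | _, _, disj t t', f => disj (subst t f) (subst t' f)
  | _, _, imp t t', f => imp (subst t f) (subst t' f)
  | _, _, sub t t', f => sub (subst t f) (subst t' f)
  | _, _, dia t, f => dia (subst t f)
  | _, _, box t, f => box (subst t f)
  | _, _, bbox t, f => bbox (subst t f)
  | _, _, bdia t, f => bdia (subst t f)
  | _, _, mu t, f => mu (subst t (Fin.cons (fvar 0) fun k => (f k).rename Fin.succ))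
  | _, _, nu t, f => nu (subst t (Fin.cons (fvar 0) fun k => (f k).rename Fin.succ))

/-- `t.substProp p α` is `t(α/p)`, where the propositional variable `p` is replaced by the
sentence `α`. -/
def substProp : {n : ℕ} → XTerm n → ℕ → XTerm 0 → XTerm n
  | _, bot, _, _ => bot
  | _, top, _, _ => top
  | _, prop q, p, α => if q = p then α.rename Fin.elim0 else prop q
  | _, nom i, _, _ => nom i
  | _, conom i, _, _ => conom i
  | _, fvar x, _, _ => fvar x
  | _, conj t t', p, α => conj (substProp t p α) (substProp t' p α)
  | _, disj t t', p, α => disj (substProp t p α) (substProp t' p α)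
  | _, imp t t', p, α => imp (substProp t p α) (substProp t' p α)
  | _, sub t t', p, α => sub (substProp t p α) (substProp t' p α)
  | _, dia t, p, α => dia (substProp t p α)
  | _, box t, p, α => box (substProp t p α)
  | _, bbox t, p, α => bbox (substProp t p α)
  | _, bdia t, p, α => bdia (substProp t p α)
  | _, mu t, p, α => mu (substProp t p α)
  | _, nu t, p, α => nu (substProp t p α)

/-- The disjunction of a finite list of formulas; the empty disjunction is `⊥`. -/
def bigDisj : List (XTerm 0) → XTerm 0
  | [] => bot
  | [α] => α
  | α :: β :: l => disj α (bigDisj (β :: l))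

/-- The conjunction of a finite list of formulas; the empty conjunction is `⊤`. -/
def bigConj : List (XTerm 0) → XTerm 0
  | [] => top
  | [α] => α
  | α :: β :: l => conj α (bigConj (β :: l))

end XTerm

/-! ## Assignments and interpretation in the canonical extension -/

/-- Values for the propositional variables, nominals and co-nominals. -/
structure Valuation (C : Type v) where
  prop : ℕ → C
  nom : ℕ → C
  conom : ℕ → C

section Semantics

variable {A : Type u} [ModalBiheytingAlgebra A] {C : Type v} [CompletelyDistribLattice C]

/-- Admissible assignments: nominals take completely join-irreducible values, co-nominals
completely meet-irreducible values, and propositional variables values in `A`. -/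
structure Valuation.IsAdmissible (e : BoundedLatticeHom A C) (V : Valuation C) : Prop where
  nom : ∀ i, IsCJI (V.nom i)
  conom : ∀ m, IsCMI (V.conom m)
  prop : ∀ p, V.prop p ∈ Set.range e

/-- The interpretation of `𝓛⁺_*` in the canonical extension. The binders `μ*` and `ν*` only take
into account pre- and post-fixed points that belong to `A`. -/
def XTerm.eval (e : BoundedLatticeHom A C) (V : Valuation C) :
    {n : ℕ} → XTerm n → (Fin n → C) → C
  | _, .bot, _ => ⊥
  | _, .top, _ => ⊤
  | _, .prop p, _ => V.prop p
  | _, .nom i, _ => V.nom i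
  | _, .conom m, _ => V.conom m
  | _, .fvar x, ρ => ρ x
  | _, .conj t t', ρ => XTerm.eval e V t ρ ⊓ XTerm.eval e V t' ρ
  | _, .disj t t', ρ => XTerm.eval e V t ρ ⊔ XTerm.eval e V t' ρ
  | _, .imp t t', ρ => XTerm.eval e V t ρ ⇨ XTerm.eval e V t' ρ
  | _, .sub t t', ρ => XTerm.eval e V t ρ \ XTerm.eval e V t' ρ
  | _, .dia t, ρ => diaC e (XTerm.eval e V t ρ)
  | _, .box t, ρ => boxC e (XTerm.eval e V t ρ)
  | _, .bbox t, ρ => bboxC e (XTerm.eval e V t ρ)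
  | _, .bdia t, ρ => bdiaC e (XTerm.eval e V t ρ)
  | _, .mu t, ρ => sInf {c | ∃ a : A, c = e a ∧ XTerm.eval e V t (Fin.cons (e a) ρ) ≤ e a}
  | _, .nu t, ρ => sSup {c | ∃ a : A, c = e a ∧ e a ≤ XTerm.eval e V t (Fin.cons (e a) ρ)}

end Semantics

/-! ## Inequalities and quasi-inequalities -/

/-- Inequalities `lhs ≤ rhs` between sentences of `𝓛⁺_*`. -/
structure Ineq where
  lhs : XTerm 0
  rhs : XTerm 0

/-- Formal inequalities. -/
infix:50 " ≼ " => Ineq.mk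

/-- Quasi-inequalities: a finite conjunction of inequalities implies an inequality. -/
structure QIneq where
  ants : List Ineq
  con : Ineq

/-- The propositional variables of an inequality. -/
def Ineq.props (x : Ineq) : Set ℕ := x.lhs.props ∪ x.rhs.props

/-- The nominals of a quasi-inequality. -/
def QIneq.noms (q : QIneq) : Set ℕ := {i | ∃ x ∈ q.con :: q.ants, i ∈ x.lhs.noms ∪ x.rhs.noms}

/-- The co-nominals of a quasi-inequality. -/
def QIneq.conoms (q : QIneq) : Set ℕ :=
  {m | ∃ x ∈ q.con :: q.ants, m ∈ x.lhs.conoms ∪ x.rhs.conoms}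

section Validity

variable {A : Type u} [ModalBiheytingAlgebra A] {C : Type v} [CompletelyDistribLattice C]

/-- Truth of an inequality under an assignment. -/
def Ineq.Holds (e : BoundedLatticeHom A C) (V : Valuation C) (x : Ineq) : Prop :=
  x.lhs.eval e V Fin.elim0 ≤ x.rhs.eval e V Fin.elim0

/-- Admissible validity of an inequality. -/
def Ineq.AdmValid (e : BoundedLatticeHom A C) (x : Ineq) : Prop :=
  ∀ V : Valuation C, V.IsAdmissible e → x.Holds e V

/-- Admissible validity of a quasi-inequality. -/
def QIneq.AdmValid (e : BoundedLatticeHom A C) (q : QIneq) : Prop :=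
  ∀ V : Valuation C, V.IsAdmissible e → (∀ x ∈ q.ants, x.Holds e V) → q.con.Holds e V

end Validity

/-! ## The rules -/

/-- First approximation of `φ* ≤ ψ*`, with the nominal `i` and the co-nominal `m`. -/
def firstApprox (φ ψ : Term 0) (i m : ℕ) : QIneq where
  ants := [.nom i ≼ φ.star, ψ.star ≼ .conom m]
  con := .nom i ≼ .conom m

open XTerm in
/-- One application of a rule, other than a fixed point approximation rule, to a
quasi-inequality. The rules act on the inequalities of the antecedent. The existential quantifiers
of the rules turn into universal ones in front of the quasi-inequality and are absorbed by the
notion of validity; accordingly a new nominal or co-nominal has to be fresh. -/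
inductive OrdStep : QIneq → QIneq → Prop
  /-- Conjunction of inequalities is associative, commutative and idempotent. -/
  | rearrange {Γ Γ' : List Ineq} {c : Ineq} (h : ∀ x, x ∈ Γ ↔ x ∈ Γ') : OrdStep ⟨Γ, c⟩ ⟨Γ', c⟩
  /-- Residuation rules; the rules for meet on the left and join on the right are also given with
  the two arguments exchanged. -/
  | subLR (χ ψ φ : XTerm 0) (Γ : List Ineq) (c : Ineq) :
      OrdStep ⟨(sub χ ψ ≼ φ) :: Γ, c⟩ ⟨(χ ≼ disj ψ φ) :: Γ, c⟩
  | impRR (φ χ ψ : XTerm 0) (Γ : List Ineq) (c : Ineq) :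
      OrdStep ⟨(φ ≼ imp χ ψ) :: Γ, c⟩ ⟨(conj φ χ ≼ ψ) :: Γ, c⟩
  | conjLR (χ ψ φ : XTerm 0) (Γ : List Ineq) (c : Ineq) :
      OrdStep ⟨(conj χ ψ ≼ φ) :: Γ, c⟩ ⟨(χ ≼ imp ψ φ) :: Γ, c⟩
  | conjLR' (χ ψ φ : XTerm 0) (Γ : List Ineq) (c : Ineq) :
      OrdStep ⟨(conj χ ψ ≼ φ) :: Γ, c⟩ ⟨(ψ ≼ imp χ φ) :: Γ, c⟩
  | disjRR (φ χ ψ : XTerm 0) (Γ : List Ineq) (c : Ineq) :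
      OrdStep ⟨(φ ≼ disj χ ψ) :: Γ, c⟩ ⟨(sub φ χ ≼ ψ) :: Γ, c⟩
  | disjRR' (φ χ ψ : XTerm 0) (Γ : List Ineq) (c : Ineq) :
      OrdStep ⟨(φ ≼ disj χ ψ) :: Γ, c⟩ ⟨(sub φ ψ ≼ χ) :: Γ, c⟩
  /-- Adjunction rules. -/
  | disjLA (φ χ ψ : XTerm 0) (Γ : List Ineq) (c : Ineq) :
      OrdStep ⟨(disj φ χ ≼ ψ) :: Γ, c⟩ ⟨(φ ≼ ψ) :: (χ ≼ ψ) :: Γ, c⟩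
  | conjRA (ψ φ χ : XTerm 0) (Γ : List Ineq) (c : Ineq) :
      OrdStep ⟨(ψ ≼ conj φ χ) :: Γ, c⟩ ⟨(ψ ≼ φ) :: (ψ ≼ χ) :: Γ, c⟩
  | diaLA (φ ψ : XTerm 0) (Γ : List Ineq) (c : Ineq) :
      OrdStep ⟨(dia φ ≼ ψ) :: Γ, c⟩ ⟨(φ ≼ bbox ψ) :: Γ, c⟩
  | boxRA (φ ψ : XTerm 0) (Γ : List Ineq) (c : Ineq) :
      OrdStep ⟨(φ ≼ box ψ) :: Γ, c⟩ ⟨(bdia φ ≼ ψ) :: Γ, c⟩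
  /-- Approximation rules. -/
  | boxAppr (ψ : XTerm 0) (m n : ℕ) (Γ : List Ineq) (c : Ineq)
      (hn : n ∉ QIneq.conoms ⟨(box ψ ≼ conom m) :: Γ, c⟩) :
      OrdStep ⟨(box ψ ≼ conom m) :: Γ, c⟩
        ⟨(box (conom n) ≼ conom m) :: (ψ ≼ conom n) :: Γ, c⟩
  | diaAppr (ψ : XTerm 0) (j i : ℕ) (Γ : List Ineq) (c : Ineq)
      (hi : i ∉ QIneq.noms ⟨(nom j ≼ dia ψ) :: Γ, c⟩) :
      OrdStep ⟨(nom j ≼ dia ψ) :: Γ, c⟩ ⟨(nom j ≼ dia (nom i)) :: (nom i ≼ ψ) :: Γ, c⟩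
  | impAppr (χ φ : XTerm 0) (m j n : ℕ) (Γ : List Ineq) (c : Ineq)
      (hj : j ∉ QIneq.noms ⟨(imp χ φ ≼ conom m) :: Γ, c⟩)
      (hn : n ∉ QIneq.conoms ⟨(imp χ φ ≼ conom m) :: Γ, c⟩) :
      OrdStep ⟨(imp χ φ ≼ conom m) :: Γ, c⟩
        ⟨(imp (nom j) (conom n) ≼ conom m) :: (nom j ≼ χ) :: (φ ≼ conom n) :: Γ, c⟩
  | subAppr (χ φ : XTerm 0) (i j n : ℕ) (Γ : List Ineq) (c : Ineq)
      (hj : j ∉ QIneq.noms ⟨(nom i ≼ sub χ φ) :: Γ, c⟩)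
      (hn : n ∉ QIneq.conoms ⟨(nom i ≼ sub χ φ) :: Γ, c⟩) :
      OrdStep ⟨(nom i ≼ sub χ φ) :: Γ, c⟩
        ⟨(nom i ≼ sub (nom j) (conom n)) :: (nom j ≼ χ) :: (φ ≼ conom n) :: Γ, c⟩
  /-- The right Ackermann rule, eliminating `p`; the inequalities in `B` are the `β ≤ γ`. -/
  | rightAckermann (p : ℕ) (αs : List (XTerm 0)) (B Γ : List Ineq) (c : Ineq)
      (hα : ∀ α ∈ αs, p ∉ α.props ∧ α.SynClosed)
      (hβ : ∀ x ∈ B, x.lhs.PosIn p ∧ x.lhs.SynClosed)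
      (hγ : ∀ x ∈ B, x.rhs.NegIn p ∧ x.rhs.SynOpen)
      (hΓ : ∀ x ∈ Γ, p ∉ x.props) (hc : p ∉ c.props) :
      OrdStep ⟨αs.map (fun α => α ≼ prop p) ++ B ++ Γ, c⟩
        ⟨B.map (fun x => x.lhs.substProp p (bigDisj αs) ≼ x.rhs.substProp p (bigDisj αs)) ++ Γ, c⟩
  /-- The left Ackermann rule, eliminating `p`; the inequalities in `B` are the `γ ≤ β`. -/
  | leftAckermann (p : ℕ) (αs : List (XTerm 0)) (B Γ : List Ineq) (c : Ineq)
      (hα : ∀ α ∈ αs, p ∉ α.props ∧ α.SynOpen)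
      (hβ : ∀ x ∈ B, x.rhs.PosIn p ∧ x.rhs.SynOpen)
      (hγ : ∀ x ∈ B, x.lhs.NegIn p ∧ x.lhs.SynClosed)
      (hΓ : ∀ x ∈ Γ, p ∉ x.props) (hc : p ∉ c.props) :
      OrdStep ⟨αs.map (fun α => prop p ≼ α) ++ B ++ Γ, c⟩
        ⟨B.map (fun x => x.lhs.substProp p (bigConj αs) ≼ x.rhs.substProp p (bigConj αs)) ++ Γ, c⟩

/-! ### Fixed point approximation rules -/

/-- The entries `1` and `∂` of order types. -/
inductive OType
  | one
  | dual

/-- Joins in `C^τ`: computed in `C` in the coordinates of type `1`, and in the order dual of `C`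
in those of type `∂`. -/
def tauSup {C : Type v} [CompleteLattice C] {n : ℕ} (τ : Fin n → OType) (S : Set (Fin n → C)) :
    Fin n → C := fun k =>
  match τ k with
  | .one => sSup ((fun ρ => ρ k) '' S)
  | .dual => sInf ((fun ρ => ρ k) '' S)

/-- Meets in `C^τ`. -/
def tauInf {C : Type v} [CompleteLattice C] {n : ℕ} (τ : Fin n → OType) (S : Set (Fin n → C)) :
    Fin n → C := fun k =>
  match τ k with
  | .one => sInf ((fun ρ => ρ k) '' S)
  | .dual => sSup ((fun ρ => ρ k) '' S)

/-- `f : C^τ → C` preserves all joins. -/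
def CompletelyJoinPreserving {C : Type v} [CompleteLattice C] {n : ℕ} (τ : Fin n → OType)
    (f : (Fin n → C) → C) : Prop :=
  ∀ S : Set (Fin n → C), f (tauSup τ S) = sSup (f '' S)

/-- `f : C^τ → C` preserves all meets. -/
def CompletelyMeetPreserving {C : Type v} [CompleteLattice C] {n : ℕ} (τ : Fin n → OType)
    (f : (Fin n → C) → C) : Prop :=
  ∀ S : Set (Fin n → C), f (tauInf τ S) = sInf (f '' S)

/-- The formula `⊥^ε`. -/
def botT : OType → XTerm 0
  | .one => .bot
  | .dual => .top

/-- The formula `⊤^ε`. -/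
def topT : OType → XTerm 0
  | .one => .top
  | .dual => .bot

/-- `j^ε`: a nominal if `ε = 1`, a co-nominal if `ε = ∂`. -/
def nomT : OType → ℕ → XTerm 0
  | .one, y => .nom y
  | .dual, y => .conom y

/-- `n^ε`: a co-nominal if `ε = 1`, a nominal if `ε = ∂`. -/
def conomT : OType → ℕ → XTerm 0
  | .one, y => .conom y
  | .dual, y => .nom y

/-- The inequality `s ≤^ε t`. -/
def leT : OType → XTerm 0 → XTerm 0 → Ineq
  | .one, s, t => s ≼ t
  | .dual, s, t => t ≼ s

/-- The tuple with `j^{τ_i}` in coordinate `i` and `⊥^{τ_k}` in every other coordinate `k`. -/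
def nomTuple {n : ℕ} (τ : Fin n → OType) (i : Fin n) (y : ℕ) : Fin n → XTerm 0 :=
  fun k => if k = i then nomT (τ i) y else botT (τ k)

/-- The tuple with `n^{τ_i}` in coordinate `i` and `⊤^{τ_k}` in every other coordinate `k`. -/
def conomTuple {n : ℕ} (τ : Fin n → OType) (i : Fin n) (y : ℕ) : Fin n → XTerm 0 :=
  fun k => if k = i then conomT (τ i) y else topT (τ k)

/-- The nominal or co-nominal `j^ε` named `y` does not occur in `q`. -/
def nomFresh (q : QIneq) : OType → ℕ → Prop
  | .one, y => y ∉ q.noms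
  | .dual, y => y ∉ q.conoms

/-- The co-nominal or nominal `n^ε` named `y` does not occur in `q`. -/
def conomFresh (q : QIneq) : OType → ℕ → Prop
  | .one, y => y ∉ q.conoms
  | .dual, y => y ∉ q.noms

section Derivations

variable {A : Type u} [ModalBiheytingAlgebra A] {C : Type v} [CompletelyDistribLattice C]

/-- One application of a rule to a quasi-inequality, producing a set of quasi-inequalities. In the
fixed point approximation rules, `X` is the variable with index `0` of the body `ψ` of the binder,
the placeholders `x₁, …, xₙ` are the variables with indices `1, …, n`, and the rule splits the
quasi-inequality into `n` quasi-inequalities. Both the body and the substituted sentences are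
formulas of `𝓛_*`. The term function of the body has to preserve joins (meets) on the canonical
extension given by `e`. -/
inductive Step (e : BoundedLatticeHom A C) : QIneq → Set QIneq → Prop
  | ord {q q' : QIneq} (h : OrdStep q q') : Step e q {q'}
  | muApprox {n : ℕ} (τ : Fin n → OType) (ψ : Term (n + 1)) (φ : Fin n → Term 0)
      (i : ℕ) (y : Fin n → ℕ) (Γ : List Ineq) (c : Ineq)
      (hψ : (Term.mu ψ).WF) (hφ : ∀ k, (φ k).WF) (hprops : ψ.props = ∅)
      (hpres : ∀ V : Valuation C, CompletelyJoinPreserving (Fin.cons .one τ) (ψ.star.eval e V))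
      (hfresh : ∀ k, nomFresh
        ⟨(.nom i ≼ (Term.mu ψ).star.subst fun l => (φ l).star) :: Γ, c⟩ (τ k) (y k)) :
      Step e ⟨(.nom i ≼ (Term.mu ψ).star.subst fun l => (φ l).star) :: Γ, c⟩
        (Set.range fun k : Fin n =>
          ⟨(.nom i ≼ (Term.mu ψ).star.subst (nomTuple τ k (y k))) ::
            leT (τ k) (nomT (τ k) (y k)) (φ k).star :: Γ, c⟩)
  | nuApprox {n : ℕ} (τ : Fin n → OType) (φ : Term (n + 1)) (ψ : Fin n → Term 0)
      (m : ℕ) (y : Fin n → ℕ) (Γ : List Ineq) (c : Ineq)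
      (hφ : (Term.nu φ).WF) (hψ : ∀ k, (ψ k).WF) (hprops : φ.props = ∅)
      (hpres : ∀ V : Valuation C, CompletelyMeetPreserving (Fin.cons .one τ) (φ.star.eval e V))
      (hfresh : ∀ k, conomFresh
        ⟨((Term.nu φ).star.subst (fun l => (ψ l).star) ≼ .conom m) :: Γ, c⟩ (τ k) (y k)) :
      Step e ⟨((Term.nu φ).star.subst (fun l => (ψ l).star) ≼ .conom m) :: Γ, c⟩
        (Set.range fun k : Fin n =>
          ⟨((Term.nu φ).star.subst (conomTuple τ k (y k)) ≼ .conom m) ::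
            leT (τ k) (ψ k).star (conomT (τ k) (y k)) :: Γ, c⟩)

/-- One application of a rule to a member of a set of quasi-inequalities. -/
def SetStep (e : BoundedLatticeHom A C) (Q Q' : Set QIneq) : Prop :=
  ∃ q ∈ Q, ∃ S : Set QIneq, Step e q S ∧ Q' = (Q \ {q}) ∪ S

/-- `Q'` is obtained from `Q` through finitely many rule applications. -/
def Derives (e : BoundedLatticeHom A C) : Set QIneq → Set QIneq → Prop :=
  Relation.ReflTransGen (SetStep e)

end Derivations

end MuALBA

-- Every rule preserves admissible validity in both directions, so both parts follow by induction
-- along the derivation, once `admValid_firstApprox` has replaced the inequality by its first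
-- approximation. That replacement is sound because every element of the canonical extension is a
-- join of completely join-irreducibles and a meet of completely meet-irreducibles. The irreducibles
-- come from the prime ideal theorem (`exists_isCJI`).
--
-- Residuation and adjunction rules only restate Galois connections; for the modal ones this needs
-- the extended diamond to preserve arbitrary joins (`diaC_sSup`). Approximation rules hold because,
-- by distributivity, completely join-irreducible elements are completely join-prime: a nominal
-- below a join is below one joinand, whose value is given to the fresh name.
--
-- The Ackermann rules are delicate because `p` may only take values in `A`, while the substituted
-- formula merely has a closed or open value `c`. By `XTerm.eval_approx`, a syntactically closed
-- formula has a closed value at `c`, and if that value lies below some `b ∈ A`, then so does the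
-- value at some element of `A` above `c`; the open and the sign-reversed versions are proved in the
-- same induction. The binder `μ*` fits in since its value is by definition a meet of elements of
-- `A`: compactness leaves finitely many pre-fixed points to be kept. Interpolating an element of
-- `A` between the two sides of each inequality then gives one value of `p` in `A` for all of them
-- (`exists_forall_eval_le`).
--
-- For fixed point approximation (`exists_isIrr_le_sInf`), a join preserving `f` splits as `f(x,σ) =
-- f(⊥,σ) ∨ f(x,⊥)`, and `f(⊥,ρ)` is the join of the `f(⊥,x)` where `x` has one irreducible entry
-- and is `⊥` elsewhere. If no such `x` worked for `j`, pre-fixed points not above `j` would cover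
-- `f(⊥,ρ)`. They form a directed family in `A`, so one of them lies above `f(⊥,ρ)` as soon as
-- `f(⊥,ρ) ∈ A`, and it is then a pre-fixed point for `ρ` itself. The second kind ensures `f(⊥,ρ) ∈
-- A`: by `Term.eval_star_of_denotes₂`, formulas of `𝓛_*` send `A` into `A`.

namespace MuALBA

/-! ## Order duality -/

/-- The order dual of a modal bi-Heyting algebra, with box and diamond exchanged. -/
instance ModalBiheytingAlgebra.orderDual {A : Type u} [ModalBiheytingAlgebra A] :
    ModalBiheytingAlgebra Aᵒᵈ where
  toBiheytingAlgebra := OrderDual.instBiheytingAlgebra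
  box a := OrderDual.toDual (ModalBiheytingAlgebra.dia (OrderDual.ofDual a))
  dia a := OrderDual.toDual (ModalBiheytingAlgebra.box (OrderDual.ofDual a))
  box_top := ModalBiheytingAlgebra.dia_bot (A := A)
  box_inf a b := ModalBiheytingAlgebra.dia_sup (OrderDual.ofDual a) (OrderDual.ofDual b)
  dia_bot := ModalBiheytingAlgebra.box_top (A := A)
  dia_sup a b := ModalBiheytingAlgebra.box_inf (OrderDual.ofDual a) (OrderDual.ofDual b)

section CanonicalExtension

variable {A : Type u} [ModalBiheytingAlgebra A] {C : Type v} [CompletelyDistribLattice C]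
  {e : BoundedLatticeHom A C}

/-- Closed and open elements, and completely join- and meet-irreducible ones, are exchanged
definitionally by passing to order duals. This is what makes the dual half of the results below
one-line applications to `Aᵒᵈ` and `Cᵒᵈ`. -/
theorem IsCanonicalExtension.dual (he : IsCanonicalExtension e) :
    IsCanonicalExtension (A := Aᵒᵈ) (C := Cᵒᵈ) (BoundedLatticeHom.dual e) where
  injective := he.injective
  dense_join := he.dense_meet
  dense_meet := he.dense_join
  compact S T h := by
    obtain ⟨T', S', hT, hS, h'⟩ := he.compact T S h
    exact ⟨S', T', hS, hT, h'⟩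

/-- The `π`-extension is the `σ`-extension taken in the dual order; the two definitions differ only
in the order of the quantifiers and conjuncts. -/
theorem boxC_eq_diaC_dual (c : C) :
    boxC e c = diaC (A := Aᵒᵈ) (C := Cᵒᵈ) (BoundedLatticeHom.dual e) c := by
  have : ∀ x : C, (∃ k w, IsClosedElem e k ∧ IsOpenElem e w ∧ k ≤ c ∧ c ≤ w ∧
      x = sSup {y | ∃ a : A, k ≤ e a ∧ e a ≤ w ∧ y = e (ModalBiheytingAlgebra.box a)}) ↔
      ∃ w k, IsOpenElem e w ∧ IsClosedElem e k ∧ c ≤ w ∧ k ≤ c ∧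
      x = sSup {y | ∃ a : A, e a ≤ w ∧ k ≤ e a ∧ y = e (ModalBiheytingAlgebra.box a)} := by
    intro x
    constructor
    · rintro ⟨k, w, hk, hw, h1, h2, h3⟩
      refine ⟨w, k, hw, hk, h2, h1, h3.trans (congrArg sSup (Set.ext fun y => ?_))⟩
      exact exists_congr fun a => and_left_comm
    · rintro ⟨w, k, hw, hk, h2, h1, h3⟩
      refine ⟨k, w, hk, hw, h1, h2, h3.trans (congrArg sSup (Set.ext fun y => ?_))⟩
      exact exists_congr fun a => and_left_comm
  exact congrArg sInf (Set.ext this)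

theorem boxC_dual (c : C) :
    boxC (A := Aᵒᵈ) (C := Cᵒᵈ) (BoundedLatticeHom.dual e) c = diaC e c :=
  boxC_eq_diaC_dual (A := Aᵒᵈ) (C := Cᵒᵈ) (e := BoundedLatticeHom.dual e) c

theorem bdiaC_eq_bboxC_dual (c : C) :
    bdiaC e c = bboxC (A := Aᵒᵈ) (C := Cᵒᵈ) (BoundedLatticeHom.dual e) c := by
  simp only [bdiaC, boxC_eq_diaC_dual]
  rfl

theorem bdiaC_dual (c : C) :
    bdiaC (A := Aᵒᵈ) (C := Cᵒᵈ) (BoundedLatticeHom.dual e) c = bboxC e c :=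
  bdiaC_eq_bboxC_dual (A := Aᵒᵈ) (C := Cᵒᵈ) (e := BoundedLatticeHom.dual e) c

/-! ## Closed and open elements -/

theorem IsClosedElem.map (e : BoundedLatticeHom A C) (a : A) : IsClosedElem e (e a) :=
  ⟨{a}, by simp⟩

theorem IsOpenElem.map (e : BoundedLatticeHom A C) (a : A) : IsOpenElem e (e a) :=
  ⟨{a}, by simp⟩

theorem IsClosedElem.eq_sInf {k : C} (hk : IsClosedElem e k) : k = sInf (e '' {a | k ≤ e a}) := by
  obtain ⟨S, rfl⟩ := hk
  refine le_antisymm (le_sInf ?_) (sInf_le_sInf ?_)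
  · rintro _ ⟨a, ha, rfl⟩
    exact ha
  · rintro _ ⟨a, ha, rfl⟩
    exact ⟨a, sInf_le ⟨a, ha, rfl⟩, rfl⟩

theorem IsOpenElem.eq_sSup {w : C} (hw : IsOpenElem e w) : w = sSup (e '' {a | e a ≤ w}) :=
  IsClosedElem.eq_sInf (A := Aᵒᵈ) (C := Cᵒᵈ) (e := BoundedLatticeHom.dual e) hw

theorem IsClosedElem.sInf {S : Set C} (hS : ∀ k ∈ S, IsClosedElem e k) :
    IsClosedElem e (sInf S) := by
  refine ⟨{a | ∃ k ∈ S, k ≤ e a}, le_antisymm (le_sInf ?_) (le_sInf fun k hk => ?_)⟩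
  · rintro _ ⟨a, ⟨k, hk, ha⟩, rfl⟩
    exact (sInf_le hk).trans ha
  · rw [(hS k hk).eq_sInf]
    refine sInf_le_sInf ?_
    rintro _ ⟨a, ha, rfl⟩
    exact ⟨a, ⟨k, hk, ha⟩, rfl⟩

theorem IsClosedElem.inf {k l : C} (hk : IsClosedElem e k) (hl : IsClosedElem e l) :
    IsClosedElem e (k ⊓ l) := by
  rw [← sInf_pair]
  refine IsClosedElem.sInf ?_
  rintro x (rfl | rfl) <;> assumption

theorem IsOpenElem.sup {k l : C} (hk : IsOpenElem e k) (hl : IsOpenElem e l) :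
    IsOpenElem e (k ⊔ l) :=
  IsClosedElem.inf (A := Aᵒᵈ) (C := Cᵒᵈ) (e := BoundedLatticeHom.dual e) hk hl

variable (he : IsCanonicalExtension e)
include he

namespace IsCanonicalExtension

theorem map_le_map {a b : A} : e a ≤ e b ↔ a ≤ b := by
  refine ⟨fun h => ?_, fun h => OrderHomClass.mono e h⟩
  have : e (a ⊓ b) = e a := by rw [map_inf]; exact inf_eq_left.2 h
  exact inf_eq_left.1 (he.injective this)

/-- Compactness as interpolation: the finite meet it provides already lies in `A`, above `k` and
below `w`. -/
theorem exists_between {k w : C} (hk : IsClosedElem e k) (hw : IsOpenElem e w) (h : k ≤ w) :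
    ∃ a, k ≤ e a ∧ e a ≤ w := by
  obtain ⟨S, rfl⟩ := hk
  obtain ⟨T, rfl⟩ := hw
  obtain ⟨S', T', hS, hT, h'⟩ := he.compact S T h
  refine ⟨S'.inf id, ?_, ?_⟩
  · rw [map_finset_inf]
    exact Finset.le_inf fun a ha => sInf_le ⟨a, hS ha, rfl⟩
  · refine (OrderHomClass.mono e h').trans ?_
    rw [map_finset_sup]
    exact Finset.sup_le fun a ha => le_sSup ⟨a, hT ha, rfl⟩

theorem exists_finset_le {S : Set A} {w : C} (hw : IsOpenElem e w) (h : sInf (e '' S) ≤ w) :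
    ∃ S' : Finset A, (S' : Set A) ⊆ S ∧ e (S'.inf id) ≤ w := by
  obtain ⟨T, rfl⟩ := hw
  obtain ⟨S', T', hS, hT, h'⟩ := he.compact S T h
  refine ⟨S', hS, (OrderHomClass.mono e h').trans ?_⟩
  rw [map_finset_sup]
  exact Finset.sup_le fun a ha => le_sSup ⟨a, hT ha, rfl⟩

theorem exists_le_finset {S : Set A} {k : C} (hk : IsClosedElem e k) (h : k ≤ sSup (e '' S)) :
    ∃ S' : Finset A, (S' : Set A) ⊆ S ∧ k ≤ e (S'.sup id) :=
  exists_finset_le (A := Aᵒᵈ) (C := Cᵒᵈ) he.dual hk h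

/-- Compactness gives a finite meet, and a down-directed family has a single member below it. -/
theorem exists_mem_le {D : Set A} {w : C} (hD : DirectedOn (· ≥ ·) D) (hne : D.Nonempty)
    (hw : IsOpenElem e w) (h : sInf (e '' D) ≤ w) : ∃ d ∈ D, e d ≤ w := by
  obtain ⟨S, hS, h'⟩ := he.exists_finset_le hw h
  suffices H : ∃ d ∈ D, d ≤ S.inf id by
    obtain ⟨d, hd, hle⟩ := H
    exact ⟨d, hd, (OrderHomClass.mono e hle).trans h'⟩
  clear h'
  induction S using Finset.cons_induction with
  | empty => obtain ⟨d, hd⟩ := hne; exact ⟨d, hd, by simp⟩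
  | cons a S ha ih =>
    obtain ⟨d, hd, hle⟩ := ih fun x hx => hS (by simp at hx ⊢; exact Or.inr hx)
    obtain ⟨d', hd', h1, h2⟩ := hD a (hS (by simp)) d hd
    refine ⟨d', hd', ?_⟩
    rw [Finset.inf_cons]
    exact le_inf h1 (h2.trans hle)

theorem exists_le_mem {D : Set A} {k : C} (hD : DirectedOn (· ≤ ·) D) (hne : D.Nonempty)
    (hk : IsClosedElem e k) (h : k ≤ sSup (e '' D)) : ∃ d ∈ D, k ≤ e d :=
  exists_mem_le (A := Aᵒᵈ) (C := Cᵒᵈ) he.dual hD hne hk h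

theorem le_of_forall_closed {c d : C} (h : ∀ k, IsClosedElem e k → k ≤ c → k ≤ d) : c ≤ d := by
  obtain ⟨K, hK, rfl⟩ := he.dense_join c
  exact sSup_le fun k hk => h k (hK k hk) (le_sSup hk)

theorem le_of_forall_open {c d : C} (h : ∀ w, IsOpenElem e w → d ≤ w → c ≤ w) : c ≤ d :=
  le_of_forall_closed (A := Aᵒᵈ) (C := Cᵒᵈ) he.dual h

/-- Interpolation characterises closedness: by meet-density, `c` is then the meet of the elements of
`A` above it. Closure of the closed elements under several operations is checked through this
criterion. -/
theorem isClosedElem_iff {c : C} :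
    IsClosedElem e c ↔ ∀ w, IsOpenElem e w → c ≤ w → ∃ a, c ≤ e a ∧ e a ≤ w := by
  refine ⟨fun hc w hw h => he.exists_between hc hw h, fun h => ⟨{a | c ≤ e a}, ?_⟩⟩
  refine le_antisymm (le_sInf ?_) (he.le_of_forall_open fun w hw hcw => ?_)
  · rintro _ ⟨a, ha, rfl⟩
    exact ha
  · obtain ⟨a, ha, haw⟩ := h w hw hcw
    exact (sInf_le (Set.mem_image_of_mem e ha)).trans haw

theorem isClosedElem_sup {k l : C} (hk : IsClosedElem e k) (hl : IsClosedElem e l) :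
    IsClosedElem e (k ⊔ l) := by
  refine he.isClosedElem_iff.2 fun w hw h => ?_
  obtain ⟨a, ha, haw⟩ := he.exists_between hk hw (le_sup_left.trans h)
  obtain ⟨b, hb, hbw⟩ := he.exists_between hl hw (le_sup_right.trans h)
  refine ⟨a ⊔ b, ?_, ?_⟩ <;> rw [map_sup]
  · exact sup_le_sup ha hb
  · exact sup_le haw hbw

theorem isOpenElem_inf {k l : C} (hk : IsOpenElem e k) (hl : IsOpenElem e l) :
    IsOpenElem e (k ⊓ l) :=
  isClosedElem_sup (A := Aᵒᵈ) (C := Cᵒᵈ) he.dual hk hl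

/-- The meets `a ⊓ b`, with `a` above `k` and `b` above `l`, form a directed family whose infimum is
at most `k ⊓ l`. -/
theorem exists_map_le_of_inf_le {k l w : C} (hk : IsClosedElem e k) (hl : IsClosedElem e l)
    (hw : IsOpenElem e w) (h : k ⊓ l ≤ w) :
    ∃ a b, k ≤ e a ∧ l ≤ e b ∧ e (a ⊓ b) ≤ w := by
  let D : Set A := {d | ∃ a b, k ≤ e a ∧ l ≤ e b ∧ d = a ⊓ b}
  have hD : DirectedOn (· ≥ ·) D := by
    rintro _ ⟨a, b, ha, hb, rfl⟩ _ ⟨a', b', ha', hb', rfl⟩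
    refine ⟨(a ⊓ a') ⊓ (b ⊓ b'), ⟨_, _, ?_, ?_, rfl⟩, ?_, ?_⟩
    · rw [map_inf]; exact le_inf ha ha'
    · rw [map_inf]; exact le_inf hb hb'
    · exact inf_le_inf inf_le_left inf_le_left
    · exact inf_le_inf inf_le_right inf_le_right
  have hne : D.Nonempty := ⟨_, ⊤, ⊤, by simp, by simp, rfl⟩
  have hle : sInf (e '' D) ≤ k ⊓ l := by
    rw [hk.eq_sInf, hl.eq_sInf]
    refine le_inf (le_sInf ?_) (le_sInf ?_)
    · rintro _ ⟨a, ha, rfl⟩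
      exact sInf_le ⟨a, ⟨a, ⊤, ha, by simp, by simp⟩, rfl⟩
    · rintro _ ⟨a, ha, rfl⟩
      exact sInf_le ⟨a, ⟨⊤, a, by simp, ha, by simp⟩, rfl⟩
  obtain ⟨_, ⟨a, b, ha, hb, rfl⟩, h'⟩ := he.exists_mem_le hD hne hw (hle.trans h)
  exact ⟨a, b, ha, hb, h'⟩

theorem exists_le_map_of_le_sup {k l w : C} (hk : IsOpenElem e k) (hl : IsOpenElem e l)
    (hw : IsClosedElem e w) (h : w ≤ k ⊔ l) :
    ∃ a b, e a ≤ k ∧ e b ≤ l ∧ w ≤ e (a ⊔ b) :=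
  exists_map_le_of_inf_le (A := Aᵒᵈ) (C := Cᵒᵈ) he.dual hk hl hw h

/-! ### The Heyting operations -/

/-- Only lattice operations are assumed to be preserved by `e`. For a closed `k` with `k ⊓ e a ≤ e
b`, compactness replaces `k` by an element of `A` above it, where residuation in `A` applies. -/
theorem map_himp (a b : A) : e (a ⇨ b) = e a ⇨ e b := by
  refine le_antisymm ?_ (he.le_of_forall_closed fun k hk h => ?_)
  · rw [le_himp_iff, ← map_inf]
    exact OrderHomClass.mono e himp_inf_le
  · obtain ⟨c, d, hc, hd, h'⟩ := he.exists_map_le_of_inf_le hk (IsClosedElem.map e a)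
      (IsOpenElem.map e b) (le_himp_iff.1 h)
    refine hc.trans (he.map_le_map.2 (le_himp_iff.2 ?_))
    exact (inf_le_inf_left c (he.map_le_map.1 hd)).trans (he.map_le_map.1 h')

theorem map_sdiff (a b : A) : e (a \ b) = e a \ e b :=
  map_himp (A := Aᵒᵈ) (C := Cᵒᵈ) he.dual b a

/-- Implication turns joins in its first argument and meets in its second into meets, so `w ⇨ k` is
bounded below by the meet of the directed family of all `e (a ⇨ b)` with `a` below `w` and `b` above
`k`. -/
theorem exists_himp_le {k w l : C} (hk : IsClosedElem e k) (hw : IsOpenElem e w)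
    (hl : IsOpenElem e l) (h : w ⇨ k ≤ l) :
    ∃ a b, e a ≤ w ∧ k ≤ e b ∧ e (a ⇨ b) ≤ l := by
  let D : Set A := {d | ∃ a b, e a ≤ w ∧ k ≤ e b ∧ d = a ⇨ b}
  have hD : DirectedOn (· ≥ ·) D := by
    rintro _ ⟨a, b, ha, hb, rfl⟩ _ ⟨a', b', ha', hb', rfl⟩
    refine ⟨(a ⊔ a') ⇨ (b ⊓ b'), ⟨_, _, ?_, ?_, rfl⟩, ?_, ?_⟩
    · rw [map_sup]; exact sup_le ha ha'
    · rw [map_inf]; exact le_inf hb hb'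
    · exact himp_le_himp le_sup_left inf_le_left
    · exact himp_le_himp le_sup_right inf_le_right
  have hne : D.Nonempty := ⟨_, ⊥, ⊤, by simp, by simp, rfl⟩
  have hle : sInf (e '' D) ≤ w ⇨ k := by
    rw [hk.eq_sInf, hw.eq_sSup, sInf_eq_iInf' (e '' {a | k ≤ e a}), sSup_eq_iSup', himp_iInf_eq]
    refine le_iInf ?_
    rintro ⟨_, b, hb, rfl⟩
    rw [iSup_himp_eq]
    refine le_iInf ?_
    rintro ⟨_, a, ha, rfl⟩
    refine sInf_le ⟨a ⇨ b, ⟨a, b, ha, hb, rfl⟩, he.map_himp a b⟩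
  obtain ⟨_, ⟨a, b, ha, hb, rfl⟩, h'⟩ := he.exists_mem_le hD hne hl (hle.trans h)
  exact ⟨a, b, ha, hb, h'⟩

theorem isClosedElem_himp {k w : C} (hw : IsOpenElem e w) (hk : IsClosedElem e k) :
    IsClosedElem e (w ⇨ k) := by
  refine he.isClosedElem_iff.2 fun l hl h => ?_
  obtain ⟨a, b, ha, hb, h'⟩ := he.exists_himp_le hk hw hl h
  refine ⟨a ⇨ b, ?_, h'⟩
  rw [he.map_himp]
  exact himp_le_himp ha hb

/-- Below an open `l`, residuation gives `k ≤ w ⊔ l`. Interpolating `b` and splitting it as `b ≤ a ⊔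
c`, with `a` below `w` and `c` below `l`, makes `b \ a` the required interpolant. -/
theorem isClosedElem_sdiff {k w : C} (hk : IsClosedElem e k) (hw : IsOpenElem e w) :
    IsClosedElem e (k \ w) := by
  refine he.isClosedElem_iff.2 fun l hl h => ?_
  obtain ⟨b, hkb, hb⟩ := he.exists_between hk (hw.sup hl) (sdiff_le_iff.1 h)
  obtain ⟨a, c, ha, hc, h'⟩ := he.exists_le_map_of_le_sup hw hl (IsClosedElem.map e b) hb
  refine ⟨b \ a, ?_, ?_⟩
  · rw [he.map_sdiff]
    exact sdiff_le_sdiff hkb ha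
  · refine (he.map_le_map.2 (sdiff_le_iff.2 ?_)).trans hc
    exact he.map_le_map.1 h'

theorem isOpenElem_himp {k w : C} (hk : IsClosedElem e k) (hw : IsOpenElem e w) :
    IsOpenElem e (k ⇨ w) :=
  isClosedElem_sdiff (A := Aᵒᵈ) (C := Cᵒᵈ) he.dual hw hk

theorem isOpenElem_sdiff {k w : C} (hw : IsOpenElem e w) (hk : IsClosedElem e k) :
    IsOpenElem e (w \ k) :=
  isClosedElem_himp (A := Aᵒᵈ) (C := Cᵒᵈ) he.dual hk hw

theorem exists_le_sdiff {k w l : C} (hw : IsOpenElem e w) (hk : IsClosedElem e k)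
    (hl : IsClosedElem e l) (h : l ≤ w \ k) :
    ∃ a b, k ≤ e a ∧ e b ≤ w ∧ l ≤ e (b \ a) :=
  exists_himp_le (A := Aᵒᵈ) (C := Cᵒᵈ) he.dual hw hk hl h

/-! ### Completely irreducible elements -/

/-- The elements of `A` above `k` form a filter disjoint from the ideal of those below `w`. A prime
ideal `J` separates the two, and the irreducible is the meet of its complement. -/
theorem exists_isCJI {k w : C} (hk : IsClosedElem e k) (hw : IsOpenElem e w) (h : ¬ k ≤ w) :
    ∃ j, IsCJI j ∧ j ≤ k ∧ ¬ j ≤ w := by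
  have hF : Order.IsPFilter {a | k ≤ e a} := by
    refine Order.IsPFilter.of_def ⟨⊤, by simp⟩ ?_ ?_
    · intro a ha b hb
      refine ⟨a ⊓ b, ?_, inf_le_left, inf_le_right⟩
      change k ≤ e (a ⊓ b)
      rw [map_inf]; exact le_inf ha hb
    · intro a b hab ha
      exact le_trans ha (OrderHomClass.mono e hab)
  have hI : Order.IsIdeal {a | e a ≤ w} := by
    refine ⟨?_, ⟨⊥, by simp⟩, ?_⟩
    · intro a b hab ha
      exact le_trans (OrderHomClass.mono e hab) ha
    · intro a ha b hb
      refine ⟨a ⊔ b, ?_, le_sup_left, le_sup_right⟩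
      change e (a ⊔ b) ≤ w
      rw [map_sup]; exact sup_le ha hb
  have hdisj : Disjoint (hF.toPFilter : Set A) (hI.toIdeal : Set A) :=
    Set.disjoint_left.2 fun a h1 h2 => h (le_trans (b := e a) h1 h2)
  obtain ⟨J, hJ, hIJ, hFJ⟩ := DistribLattice.prime_ideal_of_disjoint_filter_ideal hdisj
  have hdir : DirectedOn (· ≥ ·) ((J : Set A)ᶜ) := Order.PFilter.directed hJ.compl_filter.toPFilter
  have hne : ((J : Set A)ᶜ).Nonempty := Order.PFilter.nonempty hJ.compl_filter.toPFilter
  have hJne : (J : Set A).Nonempty := J.nonempty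
  -- The join of `J` bounds everything strictly below the meet of the complement, so this
  -- non-inequality yields complete join-irreducibility. It follows from compactness because `J` and
  -- its complement are both directed.
  have key : ¬ sInf (e '' (J : Set A)ᶜ) ≤ sSup (e '' (J : Set A)) := by
    intro hle
    obtain ⟨a, ha, hle⟩ := he.exists_mem_le hdir hne ⟨_, rfl⟩ hle
    obtain ⟨b, hb, hle⟩ := he.exists_le_mem J.directed hJne (IsClosedElem.map e a) hle
    exact ha (J.lower (he.map_le_map.1 hle) hb)
  refine ⟨sInf (e '' (J : Set A)ᶜ), fun S hS => ?_, ?_, fun hle => ?_⟩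
  · by_contra! hcon
    refine key ?_
    conv_lhs => rw [hS]
    refine sSup_le fun x hx => ?_
    have hxle : x ≤ sInf (e '' (J : Set A)ᶜ) := by rw [hS]; exact le_sSup hx
    have hnle : ¬ sInf (e '' (J : Set A)ᶜ) ≤ x := fun hle => hcon x hx (le_antisymm hle hxle)
    -- Some open `w'` above `x` is not above the meet of the complement, so every element of `A`
    -- below `w'` lies in `J`.
    obtain ⟨U, hU, hUx⟩ := he.dense_meet x
    obtain ⟨w', hw', hnw⟩ : ∃ w' ∈ U, ¬ sInf (e '' (J : Set A)ᶜ) ≤ w' := by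
      by_contra! hall
      exact hnle (by rw [hUx]; exact le_sInf hall)
    have hxw : x ≤ w' := by rw [hUx]; exact sInf_le hw'
    refine hxw.trans ?_
    rw [(hU w' hw').eq_sSup]
    refine sSup_le_sSup (Set.image_mono fun a ha => ?_)
    by_contra haJ
    exact hnw ((sInf_le (Set.mem_image_of_mem e haJ)).trans ha)
  · rw [hk.eq_sInf]
    refine sInf_le_sInf (Set.image_mono fun a ha => ?_)
    exact Set.disjoint_left.1 hFJ ha
  · refine key (hle.trans ?_)
    rw [hw.eq_sSup]
    exact sSup_le_sSup (Set.image_mono hIJ)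

theorem le_of_forall_isCJI {c d : C} (h : ∀ j, IsCJI j → j ≤ c → j ≤ d) : c ≤ d := by
  refine he.le_of_forall_closed fun k hk hkc => he.le_of_forall_open fun w hw hdw => ?_
  by_contra hkw
  obtain ⟨j, hj, hjk, hjw⟩ := he.exists_isCJI hk hw hkw
  exact hjw ((h j hj (hjk.trans hkc)).trans hdw)

theorem le_of_forall_isCMI {c d : C} (h : ∀ m, IsCMI m → d ≤ m → c ≤ m) : c ≤ d :=
  le_of_forall_isCJI (A := Aᵒᵈ) (C := Cᵒᵈ) he.dual h

theorem eq_sSup_isCJI (c : C) : c = sSup {j | IsCJI j ∧ j ≤ c} :=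
  le_antisymm (he.le_of_forall_isCJI fun _ hj hjc => le_sSup ⟨hj, hjc⟩)
    (sSup_le fun _ hj => hj.2)

theorem eq_sInf_isCMI (c : C) : c = sInf {m | IsCMI m ∧ c ≤ m} :=
  eq_sSup_isCJI (A := Aᵒᵈ) (C := Cᵒᵈ) he.dual c

theorem isClosedElem_of_isCJI {j : C} (hj : IsCJI j) : IsClosedElem e j := by
  obtain ⟨K, hK, h⟩ := he.dense_join j
  obtain ⟨k, hk, rfl⟩ := hj K h
  exact hK _ hk

theorem isOpenElem_of_isCMI {m : C} (hm : IsCMI m) : IsOpenElem e m :=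
  isClosedElem_of_isCJI (A := Aᵒᵈ) (C := Cᵒᵈ) he.dual hm

end IsCanonicalExtension

omit he in
-- Distributing `j ⊓ _` over the join turns irreducibility into complete primeness.
theorem IsCJI.exists_le {j : C} (hj : IsCJI j) {S : Set C} (h : j ≤ sSup S) : ∃ x ∈ S, j ≤ x := by
  have h' : j = sSup ((fun x => j ⊓ x) '' S) := by
    rw [sSup_image, ← inf_sSup_eq]
    exact (inf_eq_left.2 h).symm
  obtain ⟨_, ⟨x, hx, rfl⟩, hjx⟩ := hj _ h'
  exact ⟨x, hx, inf_eq_left.1 hjx.symm⟩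

omit he in
theorem IsCMI.exists_le {m : C} (hm : IsCMI m) {S : Set C} (h : sInf S ≤ m) : ∃ x ∈ S, x ≤ m :=
  IsCJI.exists_le (C := Cᵒᵈ) hm h

/-! ### The modal operations -/

namespace IsCanonicalExtension
open ModalBiheytingAlgebra

omit he in
theorem dia_mono : Monotone (dia : A → A) := fun a b h => by
  rw [← sup_eq_right.2 h, dia_sup]
  exact le_sup_left

/-- For a monotone operation the open upper bound in the `σ`-extension plays no role, and only
closed elements below `c` matter. -/
theorem diaC_eq (c : C) :
    diaC e c = sSup {x | ∃ k, IsClosedElem e k ∧ k ≤ c ∧ x = sInf (e '' (dia '' {a | k ≤ e a}))} := by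
  refine le_antisymm (sSup_le ?_) (sSup_le ?_)
  · rintro _ ⟨k, w, hk, hw, hkc, hcw, rfl⟩
    refine le_trans ?_ (le_sSup ⟨k, hk, hkc, rfl⟩)
    refine le_sInf ?_
    rintro _ ⟨_, ⟨a, ha, rfl⟩, rfl⟩
    obtain ⟨b, hkb, hbw⟩ := he.exists_between hk hw (hkc.trans hcw)
    -- Meeting with the interpolant `b` brings `a` below the open bound `w` while staying above `k`.
    refine le_trans (sInf_le (a := e (dia (a ⊓ b))) ⟨a ⊓ b, ?_, ?_, rfl⟩)
      (he.map_le_map.2 (dia_mono inf_le_left))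
    · rw [map_inf]; exact le_inf ha hkb
    · rw [map_inf]; exact inf_le_right.trans hbw
  · rintro _ ⟨k, hk, hkc, rfl⟩
    refine le_sSup ⟨k, ⊤, hk, ⟨{⊤}, by simp⟩, hkc, le_top, congrArg sInf (Set.ext fun y => ?_)⟩
    constructor
    · rintro ⟨_, ⟨a, ha, rfl⟩, rfl⟩
      exact ⟨a, ha, le_top, rfl⟩
    · rintro ⟨a, ha, -, rfl⟩
      exact ⟨_, ⟨a, ha, rfl⟩, rfl⟩

theorem diaC_mono : Monotone (diaC e) := fun c d h => by
  rw [he.diaC_eq, he.diaC_eq]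
  refine sSup_le_sSup ?_
  rintro _ ⟨k, hk, hkc, rfl⟩
  exact ⟨k, hk, hkc.trans h, rfl⟩

theorem diaC_closed {k : C} (hk : IsClosedElem e k) :
    diaC e k = sInf (e '' (dia '' {a | k ≤ e a})) := by
  rw [he.diaC_eq]
  refine le_antisymm (sSup_le ?_) (le_sSup ⟨k, hk, le_rfl, rfl⟩)
  rintro _ ⟨l, hl, hlk, rfl⟩
  refine sInf_le_sInf (Set.image_mono (Set.image_mono fun a ha => ?_))
  exact hlk.trans ha

theorem diaC_map (a : A) : diaC e (e a) = e (dia a) := by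
  rw [he.diaC_closed (IsClosedElem.map e a)]
  refine le_antisymm (sInf_le ⟨_, ⟨a, le_rfl, rfl⟩, rfl⟩) (le_sInf ?_)
  rintro _ ⟨_, ⟨b, hb, rfl⟩, rfl⟩
  exact he.map_le_map.2 (dia_mono (he.map_le_map.1 hb))

theorem isClosedElem_diaC {k : C} (hk : IsClosedElem e k) : IsClosedElem e (diaC e k) :=
  ⟨_, he.diaC_closed hk⟩

theorem exists_diaC_le {k w : C} (hk : IsClosedElem e k) (hw : IsOpenElem e w)
    (h : diaC e k ≤ w) : ∃ a, k ≤ e a ∧ e (dia a) ≤ w := by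
  rw [he.diaC_closed hk] at h
  have hD : DirectedOn (· ≥ ·) (dia '' {a | k ≤ e a}) := by
    rintro _ ⟨a, ha, rfl⟩ _ ⟨b, hb, rfl⟩
    refine ⟨dia (a ⊓ b), ⟨a ⊓ b, ?_, rfl⟩, dia_mono inf_le_left, dia_mono inf_le_right⟩
    change k ≤ e (a ⊓ b)
    rw [map_inf]; exact le_inf ha hb
  obtain ⟨_, ⟨a, ha, rfl⟩, h'⟩ := he.exists_mem_le hD ⟨_, ⊤, by simp, rfl⟩ hw h
  exact ⟨a, ha, h'⟩

/-- Let `k` be closed below the join and `w` open above all the diamonds. The elements of `A` whose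
diamond is below `w` form an ideal that covers `k`, as each irreducible below `k` is below a member
of `S`. By compactness one element of this ideal is above `k`. -/
theorem diaC_sSup (S : Set C) : diaC e (sSup S) = sSup (diaC e '' S) := by
  refine le_antisymm ?_ (sSup_le ?_)
  · rw [he.diaC_eq]
    refine sSup_le ?_
    rintro _ ⟨k, hk, hkS, rfl⟩
    rw [← he.diaC_closed hk]
    refine he.le_of_forall_open fun w hw hSw => ?_
    have hcov : k ≤ sSup (e '' {a | e (dia a) ≤ w}) := by
      refine he.le_of_forall_isCJI fun j hj hjk => ?_
      obtain ⟨x, hx, hjx⟩ := hj.exists_le (hjk.trans hkS)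
      obtain ⟨a, ha, haw⟩ := he.exists_diaC_le (he.isClosedElem_of_isCJI hj) hw
        ((he.diaC_mono hjx).trans ((le_sSup (Set.mem_image_of_mem _ hx)).trans hSw))
      exact ha.trans (le_sSup ⟨a, haw, rfl⟩)
    have hD : DirectedOn (· ≤ ·) {a : A | e (dia a) ≤ w} := by
      intro a ha b hb
      refine ⟨a ⊔ b, ?_, le_sup_left, le_sup_right⟩
      change e (dia (a ⊔ b)) ≤ w
      rw [dia_sup, map_sup]; exact sup_le ha hb
    obtain ⟨a, ha, hka⟩ := he.exists_le_mem hD ⟨⊥, by simp [dia_bot]⟩ hk hcov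
    calc diaC e k ≤ diaC e (e a) := he.diaC_mono hka
      _ = e (dia a) := he.diaC_map a
      _ ≤ w := ha
  · rintro _ ⟨x, hx, rfl⟩
    exact he.diaC_mono (le_sSup hx)

theorem gc_diaC_bboxC : GaloisConnection (diaC e) (bboxC e) := fun a b => by
  refine ⟨fun h => le_sSup h, fun h => (he.diaC_mono h).trans ?_⟩
  rw [bboxC, he.diaC_sSup]
  refine sSup_le ?_
  rintro _ ⟨x, hx, rfl⟩
  exact hx

theorem boxC_mono : Monotone (boxC e) := fun c d h => by
  rw [boxC_eq_diaC_dual, boxC_eq_diaC_dual]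
  exact diaC_mono (A := Aᵒᵈ) (C := Cᵒᵈ) he.dual h

theorem boxC_map (a : A) : boxC e (e a) = e (box a) := by
  rw [boxC_eq_diaC_dual]
  exact diaC_map (A := Aᵒᵈ) (C := Cᵒᵈ) he.dual a

theorem boxC_sInf (S : Set C) : boxC e (sInf S) = sInf (boxC e '' S) := by
  have h : boxC e = diaC (A := Aᵒᵈ) (C := Cᵒᵈ) (BoundedLatticeHom.dual e) :=
    funext boxC_eq_diaC_dual
  rw [h]
  exact diaC_sSup (A := Aᵒᵈ) (C := Cᵒᵈ) he.dual S

theorem gc_bdiaC_boxC : GaloisConnection (bdiaC e) (boxC e) := fun a b => by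
  rw [boxC_eq_diaC_dual, bdiaC_eq_bboxC_dual]
  exact (gc_diaC_bboxC (A := Aᵒᵈ) (C := Cᵒᵈ) he.dual b a).symm

theorem isOpenElem_boxC {w : C} (hw : IsOpenElem e w) : IsOpenElem e (boxC e w) := by
  rw [boxC_eq_diaC_dual]
  exact isClosedElem_diaC (A := Aᵒᵈ) (C := Cᵒᵈ) he.dual hw

theorem exists_le_boxC {k w : C} (hw : IsOpenElem e w) (hk : IsClosedElem e k)
    (h : k ≤ boxC e w) : ∃ a, e a ≤ w ∧ k ≤ e (box a) := by
  rw [boxC_eq_diaC_dual] at h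
  exact exists_diaC_le (A := Aᵒᵈ) (C := Cᵒᵈ) he.dual hw hk h

theorem boxC_closed {k : C} (hk : IsClosedElem e k) :
    boxC e k = sInf (e '' (box '' {a | k ≤ e a})) := by
  conv_lhs => rw [hk.eq_sInf, he.boxC_sInf]
  congr 1
  rw [Set.image_image, Set.image_image]
  exact Set.image_congr fun a _ => he.boxC_map a

theorem isClosedElem_boxC {k : C} (hk : IsClosedElem e k) : IsClosedElem e (boxC e k) :=
  ⟨_, he.boxC_closed hk⟩

omit he in
theorem box_mono : Monotone (box : A → A) := fun a b h => by
  rw [← inf_eq_left.2 h, box_inf]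
  exact inf_le_right

theorem exists_boxC_le {k w : C} (hk : IsClosedElem e k) (hw : IsOpenElem e w)
    (h : boxC e k ≤ w) : ∃ a, k ≤ e a ∧ e (box a) ≤ w := by
  rw [he.boxC_closed hk] at h
  have hD : DirectedOn (· ≥ ·) (box '' {a | k ≤ e a}) := by
    rintro _ ⟨a, ha, rfl⟩ _ ⟨b, hb, rfl⟩
    refine ⟨box (a ⊓ b), ⟨a ⊓ b, ?_, rfl⟩, box_mono inf_le_left, box_mono inf_le_right⟩
    change k ≤ e (a ⊓ b)
    rw [map_inf]; exact le_inf ha hb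
  obtain ⟨_, ⟨a, ha, rfl⟩, h'⟩ := he.exists_mem_le hD ⟨_, ⊤, by simp, rfl⟩ hw h
  exact ⟨a, ha, h'⟩

theorem isOpenElem_diaC {w : C} (hw : IsOpenElem e w) : IsOpenElem e (diaC e w) := by
  rw [← boxC_dual]
  exact isClosedElem_boxC (A := Aᵒᵈ) (C := Cᵒᵈ) he.dual hw

theorem exists_le_diaC {k w : C} (hw : IsOpenElem e w) (hk : IsClosedElem e k)
    (h : k ≤ diaC e w) : ∃ a, e a ≤ w ∧ k ≤ e (dia a) := by
  rw [← boxC_dual] at h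
  exact exists_boxC_le (A := Aᵒᵈ) (C := Cᵒᵈ) he.dual hw hk h

/-- Across the adjunction, `bdiaC e k ≤ w` becomes `k ≤ boxC e w`, and compactness for the box
yields the interpolant. -/
theorem isClosedElem_bdiaC {k : C} (hk : IsClosedElem e k) : IsClosedElem e (bdiaC e k) := by
  refine he.isClosedElem_iff.2 fun w hw h => ?_
  obtain ⟨a, ha, hka⟩ := he.exists_le_boxC hw hk (he.gc_bdiaC_boxC.le_iff_le.1 h)
  refine ⟨a, he.gc_bdiaC_boxC.le_iff_le.2 ?_, ha⟩
  rwa [he.boxC_map]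

theorem isOpenElem_bboxC {w : C} (hw : IsOpenElem e w) : IsOpenElem e (bboxC e w) := by
  rw [← bdiaC_dual]
  exact isClosedElem_bdiaC (A := Aᵒᵈ) (C := Cᵒᵈ) he.dual hw

end IsCanonicalExtension

end CanonicalExtension

/-! ## Signed orders and updates of assignments -/

/-- The order of `C` for the sign `true` and its dual for the sign `false`. -/
def SignedLE {C : Type v} [LE C] : Bool → C → C → Prop
  | true, x, y => x ≤ y
  | false, x, y => y ≤ x

theorem signedLE_not {C : Type v} [LE C] {s : Bool} {x y : C} :
    SignedLE (!s) x y ↔ SignedLE s y x := by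
  cases s <;> rfl

/-- Change the value of a propositional variable. -/
def Valuation.setProp {C : Type v} (V : Valuation C) (p : ℕ) (c : C) : Valuation C :=
  { V with prop := Function.update V.prop p c }

/-- Change the value of a nominal. -/
def Valuation.setNom {C : Type v} (V : Valuation C) (i : ℕ) (c : C) : Valuation C :=
  { V with nom := Function.update V.nom i c }

/-- Change the value of a co-nominal. -/
def Valuation.setConom {C : Type v} (V : Valuation C) (m : ℕ) (c : C) : Valuation C :=
  { V with conom := Function.update V.conom m c }

section Semantics

variable {A : Type u} [ModalBiheytingAlgebra A] {C : Type v} [CompletelyDistribLattice C]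
  {e : BoundedLatticeHom A C}

theorem Valuation.IsAdmissible.setProp {V : Valuation C} (hV : V.IsAdmissible e) (p : ℕ) (a : A) :
    (V.setProp p (e a)).IsAdmissible e where
  nom := hV.nom
  conom := hV.conom
  prop q := by
    by_cases h : q = p
    · subst h
      exact ⟨a, by simp [Valuation.setProp]⟩
    · simpa [Valuation.setProp, h] using hV.prop q

theorem Valuation.IsAdmissible.setNom {V : Valuation C} (hV : V.IsAdmissible e) (i : ℕ) {j : C}
    (hj : IsCJI j) : (V.setNom i j).IsAdmissible e where
  nom k := by
    by_cases h : k = i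
    · subst h
      simpa [Valuation.setNom] using hj
    · simpa [Valuation.setNom, h] using hV.nom k
  conom := hV.conom
  prop := hV.prop

theorem Valuation.IsAdmissible.setConom {V : Valuation C} (hV : V.IsAdmissible e) (m : ℕ) {n : C}
    (hn : IsCMI n) : (V.setConom m n).IsAdmissible e where
  nom := hV.nom
  conom k := by
    by_cases h : k = m
    · subst h
      simpa [Valuation.setConom] using hn
    · simpa [Valuation.setConom, h] using hV.conom k
  prop := hV.prop

namespace XTerm

/-! ## Substitution lemmas -/

theorem eval_congr {n : ℕ} (t : XTerm n) {V W : Valuation C}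
    (hp : ∀ p ∈ t.props, V.prop p = W.prop p) (hi : ∀ i ∈ t.noms, V.nom i = W.nom i)
    (hm : ∀ m ∈ t.conoms, V.conom m = W.conom m) (ρ : Fin n → C) :
    t.eval e V ρ = t.eval e W ρ := by
  induction t with
  | bot => rfl
  | top => rfl
  | prop p => exact hp p rfl
  | nom i => exact hi i rfl
  | conom m => exact hm m rfl
  | fvar x => rfl
  | conj s t ihs iht | disj s t ihs iht | imp s t ihs iht | sub s t ihs iht =>
    simp only [eval]
    rw [ihs (fun p h => hp p (Or.inl h)) (fun p h => hi p (Or.inl h)) (fun p h => hm p (Or.inl h)),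
      iht (fun p h => hp p (Or.inr h)) (fun p h => hi p (Or.inr h)) (fun p h => hm p (Or.inr h))]
  | dia t ih | box t ih | bbox t ih | bdia t ih =>
    simp only [eval]
    rw [ih hp hi hm]
  | mu t ih | nu t ih =>
    simp only [eval]
    simp_rw [ih hp hi hm]

theorem eval_setProp {n : ℕ} {t : XTerm n} {p : ℕ} (h : p ∉ t.props) (V : Valuation C) (c : C)
    (ρ : Fin n → C) : t.eval e (V.setProp p c) ρ = t.eval e V ρ := by
  refine eval_congr t (fun q hq => ?_) (fun _ _ => ?_) (fun _ _ => ?_) ρ <;> try rfl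
  exact Function.update_of_ne (ne_of_mem_of_not_mem hq h) _ _

theorem eval_setNom {n : ℕ} {t : XTerm n} {i : ℕ} (h : i ∉ t.noms) (V : Valuation C) (c : C)
    (ρ : Fin n → C) : t.eval e (V.setNom i c) ρ = t.eval e V ρ := by
  refine eval_congr t (fun _ _ => ?_) (fun q hq => ?_) (fun _ _ => ?_) ρ <;> try rfl
  exact Function.update_of_ne (ne_of_mem_of_not_mem hq h) _ _

theorem eval_setConom {n : ℕ} {t : XTerm n} {m : ℕ} (h : m ∉ t.conoms) (V : Valuation C) (c : C)
    (ρ : Fin n → C) : t.eval e (V.setConom m c) ρ = t.eval e V ρ := by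
  refine eval_congr t (fun _ _ => ?_) (fun _ _ => ?_) (fun q hq => ?_) ρ <;> try rfl
  exact Function.update_of_ne (ne_of_mem_of_not_mem hq h) _ _

theorem eval_rename {n m : ℕ} (t : XTerm n) (f : Fin n → Fin m) (V : Valuation C)
    (ρ : Fin m → C) : (t.rename f).eval e V ρ = t.eval e V (ρ ∘ f) := by
  have hcons : ∀ {n m : ℕ} (f : Fin n → Fin m) (ρ : Fin m → C) (c : C),
      (Fin.cons c ρ : Fin (m + 1) → C) ∘ (Fin.cons 0 fun k => (f k).succ : Fin (n + 1) → Fin (m + 1))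
        = Fin.cons c (ρ ∘ f) := by
    intro n m f ρ c
    funext k
    refine Fin.cases ?_ (fun k => ?_) k <;> simp
  induction t generalizing m with
  | bot | top | prop _ | nom _ | conom _ | fvar _ => rfl
  | conj s t ihs iht | disj s t ihs iht | imp s t ihs iht | sub s t ihs iht =>
    simp only [rename, eval, ihs, iht]
  | dia t ih | box t ih | bbox t ih | bdia t ih => simp only [rename, eval, ih]
  | mu t ih | nu t ih => simp only [rename, eval, ih, hcons]

theorem eval_subst {n m : ℕ} (t : XTerm n) (f : Fin n → XTerm m) (V : Valuation C)
    (ρ : Fin m → C) : (t.subst f).eval e V ρ = t.eval e V (fun k => (f k).eval e V ρ) := by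
  have hcons : ∀ {n m : ℕ} (f : Fin n → XTerm m) (ρ : Fin m → C) (c : C),
      (fun k => ((Fin.cons (fvar 0) fun k => (f k).rename Fin.succ :
        Fin (n + 1) → XTerm (m + 1)) k).eval e V (Fin.cons c ρ))
        = Fin.cons c fun k => (f k).eval e V ρ := by
    intro n m f ρ c
    funext k
    refine Fin.cases ?_ (fun k => ?_) k
    · simp [eval]
    · simp only [Fin.cons_succ, eval_rename]
      rfl
  induction t generalizing m with
  | bot | top | prop _ | nom _ | conom _ | fvar _ => rfl
  | conj s t ihs iht | disj s t ihs iht | imp s t ihs iht | sub s t ihs iht =>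
    simp only [subst, eval, ihs, iht]
  | dia t ih | box t ih | bbox t ih | bdia t ih => simp only [subst, eval, ih]
  | mu t ih | nu t ih => simp only [subst, eval, ih, hcons]

theorem eval_substProp {n : ℕ} (t : XTerm n) (p : ℕ) (α : XTerm 0) (V : Valuation C)
    (ρ : Fin n → C) :
    (t.substProp p α).eval e V ρ = t.eval e (V.setProp p (α.eval e V Fin.elim0)) ρ := by
  induction t with
  | prop q =>
    by_cases h : q = p
    · subst h
      simp only [substProp, if_true, eval_rename, eval, Valuation.setProp, Function.update_self]
      exact congrArg _ (Subsingleton.elim _ _)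
    · simp [substProp, h, eval, Valuation.setProp]
  | bot | top | nom _ | conom _ | fvar _ => rfl
  | conj s t ihs iht | disj s t ihs iht | imp s t ihs iht | sub s t ihs iht =>
    simp only [substProp, eval, ihs, iht]
  | dia t ih | box t ih | bbox t ih | bdia t ih => simp only [substProp, eval, ih]
  | mu t ih | nu t ih => simp only [substProp, eval, ih]

theorem eval_bigDisj_le {αs : List (XTerm 0)} {V : Valuation C} {c : C} :
    (bigDisj αs).eval e V Fin.elim0 ≤ c ↔ ∀ α ∈ αs, α.eval e V Fin.elim0 ≤ c := by
  induction αs with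
  | nil => simp [bigDisj, eval]
  | cons α l ih =>
    cases l with
    | nil => simp [bigDisj]
    | cons β l => simp only [bigDisj, eval, sup_le_iff, ih, List.forall_mem_cons]

theorem le_eval_bigConj {αs : List (XTerm 0)} {V : Valuation C} {c : C} :
    c ≤ (bigConj αs).eval e V Fin.elim0 ↔ ∀ α ∈ αs, c ≤ α.eval e V Fin.elim0 := by
  induction αs with
  | nil => simp [bigConj, eval]
  | cons α l ih =>
    cases l with
    | nil => simp [bigConj]
    | cons β l => simp only [bigConj, eval, le_inf_iff, ih, List.forall_mem_cons]

theorem props_bigDisj {αs : List (XTerm 0)} {p : ℕ} (h : ∀ α ∈ αs, p ∉ α.props) :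
    p ∉ (bigDisj αs).props := by
  induction αs with
  | nil => simp [bigDisj, props]
  | cons α l ih =>
    cases l with
    | nil => exact h α (by simp)
    | cons β l =>
      rintro (h' | h')
      · exact h α (by simp) h'
      · exact ih (fun γ hγ => h γ (by simp at hγ ⊢; tauto)) h'

theorem props_bigConj {αs : List (XTerm 0)} {p : ℕ} (h : ∀ α ∈ αs, p ∉ α.props) :
    p ∉ (bigConj αs).props := by
  induction αs with
  | nil => simp [bigConj, props]
  | cons α l ih =>
    cases l with
    | nil => exact h α (by simp)
    | cons β l =>
      rintro (h' | h')
      · exact h α (by simp) h'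
      · exact ih (fun γ hγ => h γ (by simp at hγ ⊢; tauto)) h'

theorem synClosed_bigDisj {αs : List (XTerm 0)} (h : ∀ α ∈ αs, α.SynClosed) :
    (bigDisj αs).SynClosed := by
  induction αs with
  | nil => simp [bigDisj, SynClosed]
  | cons α l ih =>
    cases l with
    | nil => exact h α (by simp)
    | cons β l => exact ⟨h α (by simp), ih fun γ hγ => h γ (by simp at hγ ⊢; tauto)⟩

theorem synOpen_bigConj {αs : List (XTerm 0)} (h : ∀ α ∈ αs, α.SynOpen) :
    (bigConj αs).SynOpen := by
  induction αs with
  | nil => simp [bigConj, SynOpen]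
  | cons α l ih =>
    cases l with
    | nil => exact h α (by simp)
    | cons β l => exact ⟨h α (by simp), ih fun γ hγ => h γ (by simp at hγ ⊢; tauto)⟩

theorem signedProp_of_notMem {n : ℕ} {t : XTerm n} {p : ℕ} (h : p ∉ t.props) (s : Bool) :
    t.SignedProp s p := by
  induction t generalizing s with
  | bot | top | nom _ | conom _ | fvar _ => trivial
  | prop q => exact fun hq => absurd hq.symm h
  | conj _ _ ihs iht | disj _ _ ihs iht | imp _ _ ihs iht | sub _ _ ihs iht =>
    exact ⟨ihs (fun h' => h (Or.inl h')) _, iht (fun h' => h (Or.inr h')) _⟩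
  | dia t ih | box t ih | bbox t ih | bdia t ih | mu t ih | nu t ih => exact ih h s

/-! ## Monotonicity -/

theorem eval_mono_prop (he : IsCanonicalExtension e) {n : ℕ} {t : XTerm n} {p : ℕ} {s : Bool}
    (ht : t.SignedProp s p) {V : Valuation C} {x y : C} (hxy : SignedLE s x y) (ρ : Fin n → C) :
    t.eval e (V.setProp p x) ρ ≤ t.eval e (V.setProp p y) ρ := by
  induction t generalizing s x y with
  | bot | top | nom _ | conom _ | fvar _ => exact le_rfl
  | prop q =>
    by_cases h : q = p
    · obtain rfl := ht h
      subst h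
      have hxy' : x ≤ y := hxy
      simpa [eval, Valuation.setProp] using hxy'
    · simp [eval, Valuation.setProp, h]
  | conj _ _ ihs iht => exact inf_le_inf (ihs ht.1 hxy ρ) (iht ht.2 hxy ρ)
  | disj _ _ ihs iht => exact sup_le_sup (ihs ht.1 hxy ρ) (iht ht.2 hxy ρ)
  | imp _ _ ihs iht => exact himp_le_himp (ihs ht.1 (signedLE_not.2 hxy) ρ) (iht ht.2 hxy ρ)
  | sub _ _ ihs iht => exact sdiff_le_sdiff (ihs ht.1 hxy ρ) (iht ht.2 (signedLE_not.2 hxy) ρ)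
  | dia t ih => exact he.diaC_mono (ih ht hxy ρ)
  | box t ih => exact he.boxC_mono (ih ht hxy ρ)
  | bbox t ih => exact he.gc_diaC_bboxC.monotone_u (ih ht hxy ρ)
  | bdia t ih => exact he.gc_bdiaC_boxC.monotone_l (ih ht hxy ρ)
  | mu t ih =>
    -- A smaller body has more pre-fixed points in `A`, hence a smaller infimum; positivity in the
    -- bound variable is not needed.
    refine sInf_le_sInf ?_
    rintro _ ⟨a, rfl, ha⟩
    exact ⟨a, rfl, (ih ht hxy _).trans ha⟩
  | nu t ih =>
    refine sSup_le_sSup ?_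
    rintro _ ⟨a, rfl, ha⟩
    exact ⟨a, rfl, ha.trans (ih ht hxy _)⟩

end XTerm

namespace Term

theorem eval_star_mono (he : IsCanonicalExtension e) {n : ℕ} {t : Term n} {x : Fin n} {s : Bool}
    (ht : t.SignedVar s x) (V : Valuation C) {ρ σ : Fin n → C} (hρ : ∀ y, y ≠ x → ρ y = σ y)
    (hx : SignedLE s (ρ x) (σ x)) : t.star.eval e V ρ ≤ t.star.eval e V σ := by
  have hcons : ∀ {n : ℕ} {x : Fin n} {ρ σ : Fin n → C} (c : C), (∀ y, y ≠ x → ρ y = σ y) →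
      ∀ y, y ≠ x.succ → (Fin.cons c ρ : Fin (n + 1) → C) y = (Fin.cons c σ : Fin (n + 1) → C) y := by
    intro n x ρ σ c h y
    refine Fin.cases (fun _ => rfl) (fun y hy => ?_) y
    simpa using h y (fun h' => hy (congrArg Fin.succ h'))
  induction t generalizing s with
  | bot | top | prop _ => exact le_rfl
  | fvar y =>
    by_cases h : y = x
    · obtain rfl := ht h
      subst h
      exact hx
    · exact (hρ y h).le
  | conj _ _ ihs iht => exact inf_le_inf (ihs ht.1 hρ hx) (iht ht.2 hρ hx)
  | disj _ _ ihs iht => exact sup_le_sup (ihs ht.1 hρ hx) (iht ht.2 hρ hx)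
  | imp _ _ ihs iht =>
    exact himp_le_himp (ihs ht.1 (fun y hy => (hρ y hy).symm) (signedLE_not.2 hx)) (iht ht.2 hρ hx)
  | sub _ _ ihs iht =>
    exact sdiff_le_sdiff (ihs ht.1 hρ hx) (iht ht.2 (fun y hy => (hρ y hy).symm) (signedLE_not.2 hx))
  | dia t ih => exact he.diaC_mono (ih ht hρ hx)
  | box t ih => exact he.boxC_mono (ih ht hρ hx)
  | mu t ih =>
    refine sInf_le_sInf ?_
    rintro _ ⟨a, rfl, ha⟩
    exact ⟨a, rfl, (ih ht (hcons (e a) hρ) hx).trans ha⟩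
  | nu t ih =>
    refine sSup_le_sSup ?_
    rintro _ ⟨a, rfl, ha⟩
    exact ⟨a, rfl, ha.trans (ih ht (hcons (e a) hρ) hx)⟩

theorem noms_star {n : ℕ} (t : Term n) : t.star.noms = ∅ := by
  induction t with
  | bot | top | prop _ | fvar _ => rfl
  | conj _ _ ihs iht | disj _ _ ihs iht | imp _ _ ihs iht | sub _ _ ihs iht =>
    simp only [star, XTerm.noms, ihs, iht, Set.union_empty]
  | dia t ih | box t ih | mu t ih | nu t ih => exact ih

theorem conoms_star {n : ℕ} (t : Term n) : t.star.conoms = ∅ := by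
  induction t with
  | bot | top | prop _ | fvar _ => rfl
  | conj _ _ ihs iht | disj _ _ ihs iht | imp _ _ ihs iht | sub _ _ ihs iht =>
    simp only [star, XTerm.conoms, ihs, iht, Set.union_empty]
  | dia t ih | box t ih | mu t ih | nu t ih => exact ih

theorem eval_star_congr {n : ℕ} (t : Term n) {V W : Valuation C} (h : V.prop = W.prop)
    (ρ : Fin n → C) : t.star.eval e V ρ = t.star.eval e W ρ := by
  refine t.star.eval_congr (fun p _ => congrFun h p) ?_ ?_ ρ
  · simp [noms_star]
  · simp [conoms_star]

end Term

end Semantics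

/-! ## Approximation of syntactically closed and open formulas -/

section Approximation

variable {A : Type u} [ModalBiheytingAlgebra A] {C : Type v} [CompletelyDistribLattice C]
  {e : BoundedLatticeHom A C}

/-- Closed elements for the sign `true`, open elements for the sign `false`. -/
def IsSignedClosed (e : BoundedLatticeHom A C) : Bool → C → Prop
  | true, c => IsClosedElem e c
  | false, c => IsOpenElem e c

theorem exists_signedLE {s : Bool} {c : C} : ∃ a, SignedLE s c (e a) := by
  cases s
  · exact ⟨⊥, by simp [SignedLE]⟩
  · exact ⟨⊤, by simp [SignedLE]⟩

theorem exists_signedLE_and {s : Bool} {c : C} {a b : A} (ha : SignedLE s c (e a))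
    (hb : SignedLE s c (e b)) :
    ∃ d, SignedLE s c (e d) ∧ SignedLE s (e d) (e a) ∧ SignedLE s (e d) (e b) := by
  cases s
  · exact ⟨a ⊔ b, by rw [map_sup]; exact sup_le ha hb, OrderHomClass.mono e le_sup_left,
      OrderHomClass.mono e le_sup_right⟩
  · exact ⟨a ⊓ b, by rw [map_inf]; exact le_inf ha hb, OrderHomClass.mono e inf_le_left,
      OrderHomClass.mono e inf_le_right⟩

/-- Approximants of `c` from the side given by `s` are directed towards `c`, so finitely many
properties inherited by closer approximants are met by a common one. -/
theorem exists_signedLE_forall {ι : Type*} {s : Bool} {c : C} {Q : ι → A → Prop}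
    (hQ : ∀ x a b, SignedLE s (e a) (e b) → Q x b → Q x a) (l : List ι)
    (h : ∀ x ∈ l, ∃ a, SignedLE s c (e a) ∧ Q x a) :
    ∃ a, SignedLE s c (e a) ∧ ∀ x ∈ l, Q x a := by
  induction l with
  | nil => simpa using exists_signedLE
  | cons x l ih =>
    obtain ⟨a, ha, hl⟩ := ih fun y hy => h y (List.mem_cons_of_mem _ hy)
    obtain ⟨b, hb, hx⟩ := h x List.mem_cons_self
    obtain ⟨d, hd, hda, hdb⟩ := exists_signedLE_and ha hb
    refine ⟨d, hd, List.forall_mem_cons.2 ⟨hQ _ _ _ hdb hx, fun y hy => hQ _ _ _ hda (hl y hy)⟩⟩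

/-- A topological continuity statement, proved for closed and open formulas together because
implication and subtraction swap them. The sign `s` lets one induction serve both Ackermann rules.
The free variables range over `A` only, which suffices because the binders quantify over `A`. -/
theorem XTerm.eval_approx (he : IsCanonicalExtension e) {p : ℕ} {s : Bool} {c : C}
    (hc : IsSignedClosed e s c) {V : Valuation C} (hV : V.IsAdmissible e) {n : ℕ} (t : XTerm n) :
    (t.SynClosed → t.SignedProp s p → ∀ ρ : Fin n → A,
      IsClosedElem e (t.eval e (V.setProp p c) (e ∘ ρ)) ∧
      ∀ b, t.eval e (V.setProp p c) (e ∘ ρ) ≤ e b →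
        ∃ a, SignedLE s c (e a) ∧ t.eval e (V.setProp p (e a)) (e ∘ ρ) ≤ e b) ∧
    (t.SynOpen → t.SignedProp (!s) p → ∀ ρ : Fin n → A,
      IsOpenElem e (t.eval e (V.setProp p c) (e ∘ ρ)) ∧
      ∀ b, e b ≤ t.eval e (V.setProp p c) (e ∘ ρ) →
        ∃ a, SignedLE s c (e a) ∧ e b ≤ t.eval e (V.setProp p (e a)) (e ∘ ρ)) := by
  -- For atoms other than `p` the value does not depend on the approximant, so any one will do.
  have const : ∀ {P : Prop}, P → ∃ a, SignedLE s c (e a) ∧ P := fun hP =>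
    exists_signedLE.imp fun a ha => ⟨ha, hP⟩
  have mono : ∀ {n : ℕ} {t : XTerm n} (_ : t.SignedProp s p) {a b : A}
      (_ : SignedLE s (e a) (e b)) (ρ : Fin n → C),
      t.eval e (V.setProp p (e a)) ρ ≤ t.eval e (V.setProp p (e b)) ρ :=
    fun ht _ _ hab ρ => eval_mono_prop he ht hab ρ
  have anti : ∀ {n : ℕ} {t : XTerm n} (_ : t.SignedProp (!s) p) {a b : A}
      (_ : SignedLE s (e a) (e b)) (ρ : Fin n → C),
      t.eval e (V.setProp p (e b)) ρ ≤ t.eval e (V.setProp p (e a)) ρ :=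
    fun ht _ _ hab ρ => eval_mono_prop he ht (signedLE_not.2 hab) ρ
  have hcons : ∀ {n : ℕ} (ρ : Fin n → A) (a : A),
      (Fin.cons (e a) (e ∘ ρ) : Fin (n + 1) → C) = e ∘ (Fin.cons a ρ : Fin (n + 1) → A) :=
    fun ρ a => (Fin.comp_cons e a ρ).symm
  induction t with
  | bot => exact ⟨fun _ _ _ => ⟨⟨{⊥}, by simp [eval]⟩, fun b hb => const hb⟩,
      fun _ _ _ => ⟨⟨{⊥}, by simp [eval]⟩, fun b hb => const hb⟩⟩
  | top => exact ⟨fun _ _ _ => ⟨⟨{⊤}, by simp [eval]⟩, fun b hb => const hb⟩,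
      fun _ _ _ => ⟨⟨{⊤}, by simp [eval]⟩, fun b hb => const hb⟩⟩
  | prop q =>
    by_cases h : q = p
    · subst h
      simp only [eval, Valuation.setProp, Function.update_self]
      refine ⟨fun _ hs _ => ?_, fun _ hs _ => ?_⟩
      · obtain rfl := hs rfl
        exact ⟨hc, fun b hb => ⟨b, hb, le_rfl⟩⟩
      · have hs : s = false := by simpa using hs rfl
        subst hs
        exact ⟨hc, fun b hb => ⟨b, hb, le_rfl⟩⟩
    · simp only [eval, Valuation.setProp, Function.update_of_ne h]
      obtain ⟨d, hd⟩ := hV.prop q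
      rw [← hd]
      exact ⟨fun _ _ _ => ⟨IsClosedElem.map e d, fun b hb => const hb⟩,
        fun _ _ _ => ⟨IsOpenElem.map e d, fun b hb => const hb⟩⟩
  | nom i => exact ⟨fun _ _ _ => ⟨he.isClosedElem_of_isCJI (hV.nom i), fun b hb => const hb⟩,
      fun h => h.elim⟩
  | conom m => exact ⟨fun h => h.elim,
      fun _ _ _ => ⟨he.isOpenElem_of_isCMI (hV.conom m), fun b hb => const hb⟩⟩
  | fvar x => exact ⟨fun _ _ ρ => ⟨IsClosedElem.map e (ρ x), fun b hb => const hb⟩,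
      fun _ _ ρ => ⟨IsOpenElem.map e (ρ x), fun b hb => const hb⟩⟩
  | conj t t' ih ih' =>
    refine ⟨fun ht hs ρ => ?_, fun ht hs ρ => ?_⟩
    · obtain ⟨hk, ik⟩ := ih.1 ht.1 hs.1 ρ
      obtain ⟨hl, il⟩ := ih'.1 ht.2 hs.2 ρ
      refine ⟨hk.inf hl, fun b hb => ?_⟩
      obtain ⟨b₁, b₂, h₁, h₂, h⟩ := he.exists_map_le_of_inf_le hk hl (IsOpenElem.map e b) hb
      obtain ⟨a₁, ha₁, i₁⟩ := ik b₁ h₁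
      obtain ⟨a₂, ha₂, i₂⟩ := il b₂ h₂
      obtain ⟨a, ha, h₁, h₂⟩ := exists_signedLE_and ha₁ ha₂
      refine ⟨a, ha, le_trans ?_ h⟩
      rw [map_inf]
      exact inf_le_inf ((mono hs.1 h₁ _).trans i₁) ((mono hs.2 h₂ _).trans i₂)
    · obtain ⟨hk, ik⟩ := ih.2 ht.1 hs.1 ρ
      obtain ⟨hl, il⟩ := ih'.2 ht.2 hs.2 ρ
      refine ⟨he.isOpenElem_inf hk hl, fun b hb => ?_⟩
      obtain ⟨a₁, ha₁, i₁⟩ := ik b (hb.trans inf_le_left)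
      obtain ⟨a₂, ha₂, i₂⟩ := il b (hb.trans inf_le_right)
      obtain ⟨a, ha, h₁, h₂⟩ := exists_signedLE_and ha₁ ha₂
      exact ⟨a, ha, le_inf (i₁.trans (anti hs.1 h₁ _)) (i₂.trans (anti hs.2 h₂ _))⟩
  | disj t t' ih ih' =>
    refine ⟨fun ht hs ρ => ?_, fun ht hs ρ => ?_⟩
    · obtain ⟨hk, ik⟩ := ih.1 ht.1 hs.1 ρ
      obtain ⟨hl, il⟩ := ih'.1 ht.2 hs.2 ρ
      refine ⟨he.isClosedElem_sup hk hl, fun b hb => ?_⟩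
      obtain ⟨a₁, ha₁, i₁⟩ := ik b (le_sup_left.trans hb)
      obtain ⟨a₂, ha₂, i₂⟩ := il b (le_sup_right.trans hb)
      obtain ⟨a, ha, h₁, h₂⟩ := exists_signedLE_and ha₁ ha₂
      exact ⟨a, ha, sup_le ((mono hs.1 h₁ _).trans i₁) ((mono hs.2 h₂ _).trans i₂)⟩
    · obtain ⟨hk, ik⟩ := ih.2 ht.1 hs.1 ρ
      obtain ⟨hl, il⟩ := ih'.2 ht.2 hs.2 ρ
      refine ⟨hk.sup hl, fun b hb => ?_⟩
      obtain ⟨b₁, b₂, h₁, h₂, h⟩ := he.exists_le_map_of_le_sup hk hl (IsClosedElem.map e b) hb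
      obtain ⟨a₁, ha₁, i₁⟩ := ik b₁ h₁
      obtain ⟨a₂, ha₂, i₂⟩ := il b₂ h₂
      obtain ⟨a, ha, h₁, h₂⟩ := exists_signedLE_and ha₁ ha₂
      refine ⟨a, ha, le_trans h ?_⟩
      rw [map_sup]
      exact sup_le_sup (i₁.trans (anti hs.1 h₁ _)) (i₂.trans (anti hs.2 h₂ _))
  | imp t t' ih ih' =>
    refine ⟨fun ht hs ρ => ?_, fun ht hs ρ => ?_⟩
    · obtain ⟨hk, ik⟩ := ih.2 ht.1 hs.1 ρ
      obtain ⟨hl, il⟩ := ih'.1 ht.2 hs.2 ρ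
      refine ⟨he.isClosedElem_himp hk hl, fun b hb => ?_⟩
      obtain ⟨b₁, b₂, h₁, h₂, h⟩ := he.exists_himp_le hl hk (IsOpenElem.map e b) hb
      obtain ⟨a₁, ha₁, i₁⟩ := ik b₁ h₁
      obtain ⟨a₂, ha₂, i₂⟩ := il b₂ h₂
      obtain ⟨a, ha, h₁, h₂⟩ := exists_signedLE_and ha₁ ha₂
      refine ⟨a, ha, le_trans ?_ h⟩
      rw [he.map_himp]
      exact himp_le_himp (i₁.trans (anti hs.1 h₁ _)) ((mono hs.2 h₂ _).trans i₂)
    · rw [SignedProp, Bool.not_not] at hs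
      obtain ⟨hk, ik⟩ := ih.1 ht.1 hs.1 ρ
      obtain ⟨hl, il⟩ := ih'.2 ht.2 hs.2 ρ
      refine ⟨he.isOpenElem_himp hk hl, fun b hb => ?_⟩
      -- The interpolant `d` decouples the two sides: the antecedent is to stay below `b ⇨ d` and
      -- the consequent above `d`, both bounds lying in `A`.
      obtain ⟨d, h₁, h₂⟩ := he.exists_between ((IsClosedElem.map e b).inf hk) hl (le_himp_iff.1 hb)
      obtain ⟨a₁, ha₁, i₁⟩ := ik (b ⇨ d) (by rw [he.map_himp]; exact le_himp_iff'.2 h₁)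
      obtain ⟨a₂, ha₂, i₂⟩ := il d h₂
      obtain ⟨a, ha, h₁, h₂⟩ := exists_signedLE_and ha₁ ha₂
      refine ⟨a, ha, le_himp_iff.2 ?_⟩
      have h₃ := (mono hs.1 h₁ (e ∘ ρ)).trans i₁
      rw [he.map_himp, le_himp_iff'] at h₃
      exact h₃.trans (i₂.trans (anti hs.2 h₂ _))
  | sub t t' ih ih' =>
    refine ⟨fun ht hs ρ => ?_, fun ht hs ρ => ?_⟩
    · obtain ⟨hk, ik⟩ := ih.1 ht.1 hs.1 ρ
      obtain ⟨hl, il⟩ := ih'.2 ht.2 hs.2 ρ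
      refine ⟨he.isClosedElem_sdiff hk hl, fun b hb => ?_⟩
      obtain ⟨d, h₁, h₂⟩ := he.exists_between hk (hl.sup (IsOpenElem.map e b)) (sdiff_le_iff.1 hb)
      obtain ⟨a₁, ha₁, i₁⟩ := ik d h₁
      obtain ⟨a₂, ha₂, i₂⟩ := il (d \ b) (by rw [he.map_sdiff]; exact sdiff_le_iff'.2 h₂)
      obtain ⟨a, ha, h₁, h₂⟩ := exists_signedLE_and ha₁ ha₂
      refine ⟨a, ha, sdiff_le_iff.2 ?_⟩
      have h₃ := i₂.trans (anti hs.2 h₂ (e ∘ ρ))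
      rw [he.map_sdiff, sdiff_le_iff'] at h₃
      exact ((mono hs.1 h₁ _).trans i₁).trans h₃
    · rw [SignedProp, Bool.not_not] at hs
      obtain ⟨hk, ik⟩ := ih.2 ht.1 hs.1 ρ
      obtain ⟨hl, il⟩ := ih'.1 ht.2 hs.2 ρ
      refine ⟨he.isOpenElem_sdiff hk hl, fun b hb => ?_⟩
      obtain ⟨b₂, b₁, h₂, h₁, h⟩ := he.exists_le_sdiff hk hl (IsClosedElem.map e b) hb
      obtain ⟨a₁, ha₁, i₁⟩ := ik b₁ h₁
      obtain ⟨a₂, ha₂, i₂⟩ := il b₂ h₂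
      obtain ⟨a, ha, h₁, h₂⟩ := exists_signedLE_and ha₁ ha₂
      refine ⟨a, ha, le_trans h ?_⟩
      rw [he.map_sdiff]
      exact sdiff_le_sdiff (i₁.trans (anti hs.1 h₁ _)) ((mono hs.2 h₂ _).trans i₂)
  | dia t ih =>
    refine ⟨fun ht hs ρ => ?_, fun ht hs ρ => ?_⟩
    · obtain ⟨hk, ik⟩ := ih.1 ht hs ρ
      refine ⟨he.isClosedElem_diaC hk, fun b hb => ?_⟩
      obtain ⟨d, hd, hdb⟩ := he.exists_diaC_le hk (IsOpenElem.map e b) hb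
      obtain ⟨a, ha, h⟩ := ik d hd
      refine ⟨a, ha, le_trans ?_ hdb⟩
      rw [← he.diaC_map]
      exact he.diaC_mono h
    · obtain ⟨hk, ik⟩ := ih.2 ht hs ρ
      refine ⟨he.isOpenElem_diaC hk, fun b hb => ?_⟩
      obtain ⟨d, hd, hdb⟩ := he.exists_le_diaC hk (IsClosedElem.map e b) hb
      obtain ⟨a, ha, h⟩ := ik d hd
      refine ⟨a, ha, hdb.trans ?_⟩
      rw [← he.diaC_map]
      exact he.diaC_mono h
  | box t ih =>
    refine ⟨fun ht hs ρ => ?_, fun ht hs ρ => ?_⟩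
    · obtain ⟨hk, ik⟩ := ih.1 ht hs ρ
      refine ⟨he.isClosedElem_boxC hk, fun b hb => ?_⟩
      obtain ⟨d, hd, hdb⟩ := he.exists_boxC_le hk (IsOpenElem.map e b) hb
      obtain ⟨a, ha, h⟩ := ik d hd
      refine ⟨a, ha, le_trans ?_ hdb⟩
      rw [← he.boxC_map]
      exact he.boxC_mono h
    · obtain ⟨hk, ik⟩ := ih.2 ht hs ρ
      refine ⟨he.isOpenElem_boxC hk, fun b hb => ?_⟩
      obtain ⟨d, hd, hdb⟩ := he.exists_le_boxC hk (IsClosedElem.map e b) hb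
      obtain ⟨a, ha, h⟩ := ik d hd
      refine ⟨a, ha, hdb.trans ?_⟩
      rw [← he.boxC_map]
      exact he.boxC_mono h
  | bbox t ih =>
    refine ⟨fun ht => ht.elim, fun ht hs ρ => ?_⟩
    obtain ⟨hk, ik⟩ := ih.2 ht hs ρ
    refine ⟨he.isOpenElem_bboxC hk, fun b hb => ?_⟩
    -- Moving the operator across the adjunction turns the bound into a diamond of an element of
    -- `A`, again in `A`, so the induction hypothesis applies.
    have hb := (he.gc_diaC_bboxC _ _).2 hb
    rw [he.diaC_map] at hb
    obtain ⟨a, ha, h⟩ := ik _ hb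
    refine ⟨a, ha, (he.gc_diaC_bboxC _ _).1 ?_⟩
    rwa [he.diaC_map]
  | bdia t ih =>
    refine ⟨fun ht hs ρ => ?_, fun ht => ht.elim⟩
    obtain ⟨hk, ik⟩ := ih.1 ht hs ρ
    refine ⟨he.isClosedElem_bdiaC hk, fun b hb => ?_⟩
    have hb := (he.gc_bdiaC_boxC _ _).1 hb
    rw [he.boxC_map] at hb
    obtain ⟨a, ha, h⟩ := ik _ hb
    refine ⟨a, ha, (he.gc_bdiaC_boxC _ _).2 ?_⟩
    rwa [he.boxC_map]
  | mu t ih =>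
    refine ⟨fun ht hs ρ => ?_, fun ht => ht.elim⟩
    have hset : (mu t).eval e (V.setProp p c) (e ∘ ρ) =
        sInf (e '' {a | t.eval e (V.setProp p c) (Fin.cons (e a) (e ∘ ρ)) ≤ e a}) := by
      refine congrArg sInf (Set.ext fun x => ?_)
      exact ⟨fun ⟨a, hx, ha⟩ => ⟨a, ha, hx.symm⟩, fun ⟨a, ha, hx⟩ => ⟨a, hx.symm, ha⟩⟩
    refine ⟨⟨_, hset⟩, fun b hb => ?_⟩
    rw [hset] at hb
    -- Finitely many pre-fixed points already have their meet below `b`. Each one bounds the body by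
    -- an element of `A`, so it remains a pre-fixed point for some approximant, and a common
    -- approximant serves them all.
    obtain ⟨S, hS, hSb⟩ := he.exists_finset_le (IsOpenElem.map e b) hb
    obtain ⟨a, ha, h⟩ := exists_signedLE_forall (s := s) (c := c) (e := e)
      (Q := fun d a => t.eval e (V.setProp p (e a)) (Fin.cons (e d) (e ∘ ρ)) ≤ e d)
      (fun d a b hab h => (mono (t := t) hs hab _).trans h) S.toList (fun d hd => by
        have hd' := hS (Finset.mem_toList.1 hd)
        rw [Set.mem_ofPred_eq, hcons] at hd'
        simpa only [hcons] using (ih.1 ht hs (Fin.cons d ρ)).2 d hd')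
    refine ⟨a, ha, le_trans ?_ hSb⟩
    rw [map_finset_inf]
    exact Finset.le_inf fun d hd => sInf_le ⟨d, rfl, h d (Finset.mem_toList.2 hd)⟩
  | nu t ih =>
    refine ⟨fun ht => ht.elim, fun ht hs ρ => ?_⟩
    have hset : (nu t).eval e (V.setProp p c) (e ∘ ρ) =
        sSup (e '' {a | e a ≤ t.eval e (V.setProp p c) (Fin.cons (e a) (e ∘ ρ))}) := by
      refine congrArg sSup (Set.ext fun x => ?_)
      exact ⟨fun ⟨a, hx, ha⟩ => ⟨a, ha, hx.symm⟩, fun ⟨a, ha, hx⟩ => ⟨a, hx.symm, ha⟩⟩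
    refine ⟨⟨_, hset⟩, fun b hb => ?_⟩
    rw [hset] at hb
    obtain ⟨S, hS, hSb⟩ := he.exists_le_finset (IsClosedElem.map e b) hb
    obtain ⟨a, ha, h⟩ := exists_signedLE_forall (s := s) (c := c) (e := e)
      (Q := fun d a => e d ≤ t.eval e (V.setProp p (e a)) (Fin.cons (e d) (e ∘ ρ)))
      (fun d a b hab h => h.trans (anti (t := t) hs hab _)) S.toList (fun d hd => by
        have hd' := hS (Finset.mem_toList.1 hd)
        rw [Set.mem_ofPred_eq, hcons] at hd'
        simpa only [hcons] using (ih.2 ht hs (Fin.cons d ρ)).2 d hd')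
    refine ⟨a, ha, le_trans hSb ?_⟩
    rw [map_finset_sup]
    exact Finset.sup_le fun d hd => le_sSup ⟨d, rfl, h d (Finset.mem_toList.2 hd)⟩

/-- Since `p` does not occur, `XTerm.eval_approx` can be applied with `p` set to `⊤`, which is both
closed and open. -/
theorem XTerm.isSignedClosed_eval (he : IsCanonicalExtension e) {V : Valuation C}
    (hV : V.IsAdmissible e) {s : Bool} {t : XTerm 0}
    (h : (s = true ∧ t.SynClosed) ∨ (s = false ∧ t.SynOpen)) {p : ℕ} (hp : p ∉ t.props) :
    IsSignedClosed e s (t.eval e V Fin.elim0) := by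
  have hρ : (Fin.elim0 : Fin 0 → C) = e ∘ (Fin.elim0 : Fin 0 → A) := Subsingleton.elim _ _
  rw [← eval_setProp hp V ⊤, hρ]
  obtain ⟨rfl, ht⟩ | ⟨rfl, ht⟩ := h
  · exact ((t.eval_approx (p := p) (s := true) he ⟨{⊤}, by simp⟩ hV).1 ht
      (signedProp_of_notMem hp _) _).1
  · exact ((t.eval_approx (p := p) (s := false) he ⟨{⊤}, by simp⟩ hV).2 ht
      (signedProp_of_notMem hp _) _).1

/-- The semantic content of the Ackermann rules. -/
theorem exists_forall_eval_le (he : IsCanonicalExtension e) {p : ℕ} {s : Bool} {c : C}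
    (hc : IsSignedClosed e s c) {V : Valuation C} (hV : V.IsAdmissible e) (B : List Ineq)
    (hl : ∀ x ∈ B, x.lhs.SynClosed ∧ x.lhs.SignedProp s p)
    (hr : ∀ x ∈ B, x.rhs.SynOpen ∧ x.rhs.SignedProp (!s) p)
    (hB : ∀ x ∈ B, x.Holds e (V.setProp p c)) :
    ∃ a, SignedLE s c (e a) ∧ ∀ x ∈ B, x.Holds e (V.setProp p (e a)) := by
  have hρ : (Fin.elim0 : Fin 0 → C) = e ∘ (Fin.elim0 : Fin 0 → A) := Subsingleton.elim _ _
  -- Indexing by members of `B`, rather than by arbitrary inequalities, keeps their sign conditions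
  -- available for monotonicity.
  have := exists_signedLE_forall (s := s) (c := c) (e := e)
    (Q := fun (x : {x // x ∈ B}) a => x.1.Holds e (V.setProp p (e a)))
    (fun x a b hab h => (XTerm.eval_mono_prop he (hl _ x.2).2 hab _).trans
      (h.trans (XTerm.eval_mono_prop he (hr _ x.2).2 (signedLE_not.2 hab) _))) B.attach ?_
  · obtain ⟨a, ha, h⟩ := this
    exact ⟨a, ha, fun x hx => h ⟨x, hx⟩ (List.mem_attach _ _)⟩
  · rintro ⟨x, hx⟩ -
    have h := hB x hx
    obtain ⟨hk, ik⟩ := (x.lhs.eval_approx he hc hV).1 (hl x hx).1 (hl x hx).2 Fin.elim0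
    obtain ⟨hw, iw⟩ := (x.rhs.eval_approx he hc hV).2 (hr x hx).1 (hr x hx).2 Fin.elim0
    rw [Ineq.Holds, hρ] at h
    obtain ⟨b, hkb, hbw⟩ := he.exists_between hk hw h
    obtain ⟨a₁, ha₁, i₁⟩ := ik b hkb
    obtain ⟨a₂, ha₂, i₂⟩ := iw b hbw
    obtain ⟨a, ha, h₁, h₂⟩ := exists_signedLE_and ha₁ ha₂
    refine ⟨a, ha, ?_⟩
    rw [Ineq.Holds, hρ]
    exact ((XTerm.eval_mono_prop he (hl x hx).2 h₁ _).trans i₁).trans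
      (i₂.trans (XTerm.eval_mono_prop he (hr x hx).2 (signedLE_not.2 h₂) _))

end Approximation

/-! ## Mu-algebras of the second kind -/

/-- The join of the transfinite approximants of a monotone map, computed in a poset, is the least
pre-fixed point. -/
theorem isLeast_of_approximants {P : Type u} [PartialOrder P] [OrderBot P] {F : P → P}
    (hF : Monotone F) {s : Ordinal.{u} → P} (h₀ : s 0 = ⊥)
    (hs : ∀ α, s (Order.succ α) = F (s α))
    (hl : ∀ l, Order.IsSuccLimit l → IsLUB (s '' Set.Iio l) (s l)) {a : P}
    (ha : IsLUB (Set.range s) a) : IsLeast {b | F b ≤ b} a := by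
  have hinc : ∀ α, s α ≤ F (s α) := by
    intro α
    induction α using SuccOrder.limitRecOn with
    | isMin α h =>
      rw [h.eq_bot, Ordinal.bot_eq_zero, h₀]
      exact bot_le
    | succ α _ ih =>
      rw [hs]
      exact hF ih
    | isSuccLimit α h ih =>
      refine (isLUB_le_iff (hl α h)).2 ?_
      rintro _ ⟨β, hβ, rfl⟩
      exact (ih β hβ).trans (hF ((hl α h).1 ⟨β, hβ, rfl⟩))
  have hmono : ∀ β α, α ≤ β → s α ≤ s β := by
    intro β
    induction β using SuccOrder.limitRecOn with
    | isMin β h =>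
      intro α hα
      rw [le_antisymm hα (h.eq_bot ▸ bot_le)]
    | succ β _ ih =>
      intro α hα
      obtain rfl | hα := hα.eq_or_lt
      · exact le_rfl
      · rw [hs]
        exact (ih α (Order.lt_succ_iff.1 hα)).trans (hinc β)
    | isSuccLimit β h ih =>
      intro α hα
      obtain rfl | hα := hα.eq_or_lt
      · exact le_rfl
      · exact (hl β h).1 ⟨α, hα, rfl⟩
  have hle : ∀ b, F b ≤ b → ∀ α, s α ≤ b := by
    intro b hb α
    induction α using SuccOrder.limitRecOn with
    | isMin α h =>
      rw [h.eq_bot, Ordinal.bot_eq_zero, h₀]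
      exact bot_le
    | succ α _ ih =>
      rw [hs]
      exact (hF ih).trans hb
    | isSuccLimit α h ih =>
      refine (isLUB_le_iff (hl α h)).2 ?_
      rintro _ ⟨β, hβ, rfl⟩
      exact ih β hβ
  -- The ordinals of universe `u` do not inject into `P : Type u`, so two stages agree. As the
  -- stages increase, the sequence is stationary from the earlier one on.
  obtain ⟨α, hα⟩ : ∃ α, F (s α) ≤ s α := by
    have := not_injective_of_ordinal s
    simp only [Function.Injective, not_forall] at this
    obtain ⟨α, β, hαβ, hne⟩ := this
    wlog h : α < β generalizing α β
    · exact this β α hαβ.symm (Ne.symm hne) (lt_of_le_of_ne (not_lt.1 h) (Ne.symm hne))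
    refine ⟨α, ?_⟩
    rw [← hs, hαβ]
    exact hmono _ _ (Order.succ_le_of_lt h)
  have haα : a = s α := by
    refine le_antisymm ((isLUB_le_iff ha).2 ?_) (ha.1 ⟨α, rfl⟩)
    rintro _ ⟨β, rfl⟩
    exact hle _ hα β
  subst haα
  exact ⟨hα, fun b hb => hle b hb α⟩

theorem isGreatest_of_approximants {P : Type u} [PartialOrder P] [OrderTop P] {F : P → P}
    (hF : Monotone F) {s : Ordinal.{u} → P} (h₀ : s 0 = ⊤)
    (hs : ∀ α, s (Order.succ α) = F (s α))
    (hl : ∀ l, Order.IsSuccLimit l → IsGLB (s '' Set.Iio l) (s l)) {a : P}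
    (ha : IsGLB (Set.range s) a) : IsGreatest {b | b ≤ F b} a :=
  isLeast_of_approximants (s := OrderDual.toDual ∘ s) hF.dual h₀ hs hl ha

section SecondKind

variable {A : Type u} [ModalBiheytingAlgebra A] {C : Type v} [CompletelyDistribLattice C]
  {e : BoundedLatticeHom A C}

/-- The approximants converge to an actual least pre-fixed point in `A`, which is therefore the
minimum of the set whose infimum defines `μ*`. Dually for `ν*`. -/
theorem Term.eval_star_of_denotes₂ (he : IsCanonicalExtension e) (hA : IsSecondKind A)
    {V : Valuation C} {v : ℕ → A} (hV : V.prop = e ∘ v) {n : ℕ} (t : Term n) (ht : t.WF)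
    (ρ : Fin n → A) (a : A) (h : t.Denotes₂ v ρ a) : t.star.eval e V (e ∘ ρ) = e a := by
  have hcons : ∀ {n : ℕ} (ρ : Fin n → A) (a : A),
      (Fin.cons (e a) (e ∘ ρ) : Fin (n + 1) → C) = e ∘ (Fin.cons a ρ : Fin (n + 1) → A) :=
    fun ρ a => (Fin.comp_cons e a ρ).symm
  have hmono : ∀ {n : ℕ} {t : Term (n + 1)} (_ : t.SignedVar true 0) (ρ : Fin n → A) (F : A → A)
      (_ : ∀ b, t.star.eval e V (e ∘ (Fin.cons b ρ : Fin (n + 1) → A)) = e (F b)),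
      Monotone F := by
    intro n t ht ρ F hF b c hbc
    rw [← he.map_le_map, ← hF, ← hF]
    refine eval_star_mono he ht V (fun y hy => ?_) (OrderHomClass.mono e hbc)
    obtain ⟨y, rfl⟩ := Fin.exists_succ_eq.2 hy
    rfl
  induction t generalizing a with
  | bot => rw [show a = ⊥ from h, map_bot]; rfl
  | top => rw [show a = ⊤ from h, map_top]; rfl
  | prop p =>
    rw [show a = v p from h]
    exact congrFun hV p
  | fvar x => rw [show a = ρ x from h]; rfl
  | conj s t ihs iht =>
    obtain ⟨b, c, hb, hc, rfl⟩ := h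
    rw [map_inf, ← ihs ht.1 ρ b hb, ← iht ht.2 ρ c hc]; rfl
  | disj s t ihs iht =>
    obtain ⟨b, c, hb, hc, rfl⟩ := h
    rw [map_sup, ← ihs ht.1 ρ b hb, ← iht ht.2 ρ c hc]; rfl
  | imp s t ihs iht =>
    obtain ⟨b, c, hb, hc, rfl⟩ := h
    rw [he.map_himp, ← ihs ht.1 ρ b hb, ← iht ht.2 ρ c hc]; rfl
  | sub s t ihs iht =>
    obtain ⟨b, c, hb, hc, rfl⟩ := h
    rw [he.map_sdiff, ← ihs ht.1 ρ b hb, ← iht ht.2 ρ c hc]; rfl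
  | dia t ih =>
    obtain ⟨b, hb, rfl⟩ := h
    rw [← he.diaC_map, ← ih ht ρ b hb]; rfl
  | box t ih =>
    obtain ⟨b, hb, rfl⟩ := h
    rw [← he.boxC_map, ← ih ht ρ b hb]; rfl
  | mu t ih =>
    obtain ⟨s, h₀, hs, hl, ha⟩ := h
    -- `Denotes₂` is only a relation, so a term function is chosen; the induction hypothesis and
    -- injectivity of `e` force the given approximants to follow it.
    choose F hF using fun b => hA _ t ht.2 v (Fin.cons b ρ)
    have hev := fun b => ih ht.2 _ _ (hF b)
    have hleast := isLeast_of_approximants (hmono ht.1 ρ F hev) h₀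
      (fun α => he.injective ((ih ht.2 _ _ (hs α)).symm.trans (hev _))) hl ha
    refine le_antisymm (sInf_le ⟨a, rfl, ?_⟩) (le_sInf ?_)
    · rw [hcons, hev]
      exact he.map_le_map.2 hleast.1
    · rintro _ ⟨b, rfl, hb⟩
      rw [hcons, hev] at hb
      exact he.map_le_map.2 (hleast.2 (he.map_le_map.1 hb))
  | nu t ih =>
    obtain ⟨s, h₀, hs, hl, ha⟩ := h
    choose F hF using fun b => hA _ t ht.2 v (Fin.cons b ρ)
    have hev := fun b => ih ht.2 _ _ (hF b)
    have hgreatest := isGreatest_of_approximants (hmono ht.1 ρ F hev) h₀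
      (fun α => he.injective ((ih ht.2 _ _ (hs α)).symm.trans (hev _))) hl ha
    refine le_antisymm (sSup_le ?_) (le_sSup ⟨a, rfl, ?_⟩)
    · rintro _ ⟨b, rfl, hb⟩
      rw [hcons, hev] at hb
      exact he.map_le_map.2 (hgreatest.2 (he.map_le_map.1 hb))
    · rw [hcons, hev]
      exact he.map_le_map.2 hgreatest.1

theorem Term.eval_star_mem_range (he : IsCanonicalExtension e) (hA : IsSecondKind A)
    {V : Valuation C} (hV : ∀ p, V.prop p ∈ Set.range e) {n : ℕ} {t : Term n} (ht : t.WF)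
    {ρ : Fin n → C} (hρ : ∀ x, ρ x ∈ Set.range e) : t.star.eval e V ρ ∈ Set.range e := by
  choose v hv using hV
  choose σ hσ using hρ
  obtain ⟨a, ha⟩ := hA n t ht v σ
  obtain rfl : e ∘ σ = ρ := funext hσ
  exact ⟨a, (eval_star_of_denotes₂ he hA (funext fun p => (hv p).symm) t ht σ a ha).symm⟩

end SecondKind

/-! ## Join preserving maps on products of a lattice and its dual -/

namespace OType

variable {C : Type v} [CompleteLattice C]

/-- The order of `C^ε`. -/
def le : OType → C → C → Prop
  | one, x, y => x ≤ y
  | dual, x, y => y ≤ x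

/-- The least element of `C^ε`. -/
def bot : OType → C
  | one => ⊥
  | dual => ⊤

/-- Binary joins of `C^ε`. -/
def join : OType → C → C → C
  | one, x, y => x ⊔ y
  | dual, x, y => x ⊓ y

/-- Completely join-irreducible elements of `C^ε`. -/
def IsIrr : OType → C → Prop
  | one, x => IsCJI x
  | dual, x => IsCMI x

theorem join_eq_right {ε : OType} {x y : C} (h : ε.le x y) : ε.join x y = y := by
  cases ε
  · exact sup_eq_right.2 h
  · exact inf_eq_right.2 h

theorem join_bot (ε : OType) (x : C) : ε.join x ε.bot = x := by
  cases ε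
  · exact sup_bot_eq x
  · exact inf_top_eq x

theorem bot_le (ε : OType) (x : C) : ε.le ε.bot x := by
  cases ε
  · exact _root_.bot_le
  · exact le_top

theorem le_refl (ε : OType) (x : C) : ε.le x x := by
  cases ε <;> exact le_rfl

end OType

section JoinPreserving

variable {C : Type v} [CompleteLattice C] {n : ℕ} {τ : Fin n → OType} {f : (Fin n → C) → C}

theorem CompletelyMeetPreserving.dual (hf : CompletelyMeetPreserving τ f) :
    CompletelyJoinPreserving (C := Cᵒᵈ) τ f := by
  intro S
  refine Eq.trans (congrArg f (funext fun k => ?_)) (hf S)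
  unfold tauSup tauInf
  cases τ k <;> rfl

theorem CompletelyJoinPreserving.map_join (hf : CompletelyJoinPreserving τ f)
    (σ σ' : Fin n → C) : f (fun k => (τ k).join (σ k) (σ' k)) = f σ ⊔ f σ' := by
  have := hf {σ, σ'}
  rw [Set.image_pair, sSup_pair] at this
  rw [← this]
  refine congrArg f (funext fun k => ?_)
  unfold tauSup
  cases τ k <;> simp [OType.join, Set.image_pair]

theorem CompletelyJoinPreserving.mono (hf : CompletelyJoinPreserving τ f)
    {σ σ' : Fin n → C} (h : ∀ k, (τ k).le (σ k) (σ' k)) : f σ ≤ f σ' := by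
  have := hf.map_join σ σ'
  simp only [fun k => OType.join_eq_right (h k)] at this
  rw [this]
  exact le_sup_left

theorem CompletelyJoinPreserving.map_bot (hf : CompletelyJoinPreserving τ f) :
    f (fun k => (τ k).bot) = ⊥ := by
  have := hf ∅
  rw [Set.image_empty, sSup_empty] at this
  rw [← this]
  refine congrArg f (funext fun k => ?_)
  unfold tauSup
  cases τ k <;> simp [OType.bot]

end JoinPreserving

-- Irreducible witnesses for fixed points of join preserving maps

section FixedPointApproximation

variable {A : Type u} [ModalBiheytingAlgebra A] {C : Type v} [CompletelyDistribLattice C]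
  {e : BoundedLatticeHom A C}

theorem IsCJI.not_le_bot {j : C} (hj : IsCJI j) : ¬ j ≤ ⊥ := fun h => by
  obtain ⟨x, hx, -⟩ := hj ∅ (by simpa using h)
  exact hx

theorem IsCJI.le_or_le {j x y : C} (hj : IsCJI j) (h : j ≤ x ⊔ y) : j ≤ x ∨ j ≤ y := by
  rw [← sSup_pair] at h
  obtain ⟨z, rfl | rfl, hz⟩ := hj.exists_le h
  exacts [Or.inl hz, Or.inr hz]

/-- The semantic content of the fixed point approximation rule for `μ*`. -/
theorem exists_isIrr_le_sInf (he : IsCanonicalExtension e) {n : ℕ} {τ : Fin n → OType}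
    {f : (Fin (n + 1) → C) → C} (hf : CompletelyJoinPreserving (Fin.cons .one τ) f)
    {ρ : Fin n → C} (hρ : f (Fin.cons ⊥ ρ) ∈ Set.range e) {j : C} (hj : IsCJI j)
    (h : j ≤ sInf {c | ∃ a : A, c = e a ∧ f (Fin.cons (e a) ρ) ≤ e a}) :
    ∃ k x, (τ k).IsIrr x ∧ (τ k).le x (ρ k) ∧ j ≤ sInf {c | ∃ a : A, c = e a ∧
      f (Fin.cons (e a) fun l => if l = k then x else (τ l).bot) ≤ e a} := by
  by_contra! hcon
  let o : Fin n → C := fun l => (τ l).bot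
  have hmono : ∀ {x y : C} {σ σ' : Fin n → C}, x ≤ y → (∀ k, (τ k).le (σ k) (σ' k)) →
      f (Fin.cons x σ) ≤ f (Fin.cons y σ') := by
    intro x y σ σ' hxy hσ
    refine hf.mono fun k => ?_
    refine Fin.cases hxy (fun k => ?_) k
    simpa using hσ k
  -- In the product order `(x, σ)` is the join of `(⊥, σ)` and `(x, o)`.
  have hsplit : ∀ (x : C) (σ : Fin n → C),
      f (Fin.cons x σ) = f (Fin.cons ⊥ σ) ⊔ f (Fin.cons x o) := by
    intro x σ
    rw [← hf.map_join]
    refine congrArg f (funext fun k => ?_)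
    refine Fin.cases ?_ (fun k => ?_) k
    · exact (bot_sup_eq x).symm
    · simpa using ((τ k).join_bot (σ k)).symm
  have hjoin : ∀ x y : C, f (Fin.cons (x ⊔ y) o) = f (Fin.cons x o) ⊔ f (Fin.cons y o) := by
    intro x y
    rw [← hf.map_join]
    refine congrArg f (funext fun k => ?_)
    refine Fin.cases rfl (fun k => ?_) k
    simpa using ((τ k).join_bot _).symm
  have hbot : f (Fin.cons ⊥ o) = ⊥ := by
    refine (congrArg f (funext fun k => ?_)).trans hf.map_bot
    refine Fin.cases rfl (fun k => ?_) k
    simp [o]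
  -- These tuples, nontrivial in a single coordinate, have join `(⊥, ρ)` because irreducibles of
  -- each `C^ε` generate it.
  let T : Set (Fin (n + 1) → C) := {σ | ∃ k x, (τ k).IsIrr x ∧ (τ k).le x (ρ k) ∧
    σ = Fin.cons ⊥ fun l => if l = k then x else (τ l).bot}
  have hT : tauSup (Fin.cons .one τ) T = Fin.cons ⊥ ρ := by
    funext k
    refine Fin.cases ?_ (fun k => ?_) k
    · change sSup ((fun σ : Fin (n + 1) → C => σ 0) '' T) = ⊥
      refine le_bot_iff.1 (sSup_le ?_)
      rintro _ ⟨_, ⟨k, x, -, -, rfl⟩, rfl⟩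
      exact le_rfl
    · have key : ∀ ε : OType, ε = τ k → tauSup (Fin.cons .one τ) T k.succ = ρ k := by
        intro ε hε
        unfold tauSup
        simp only [Fin.cons_succ]
        rw [← hε]
        cases ε
        · refine le_antisymm (sSup_le ?_) (he.le_of_forall_isCJI fun x hx hxk =>
            le_sSup ⟨_, ⟨k, x, ?_, ?_, rfl⟩, ?_⟩)
          · rintro _ ⟨_, ⟨l, x, -, hx, rfl⟩, rfl⟩
            by_cases hkl : k = l
            · subst hkl
              rw [← hε] at hx
              have hx : x ≤ ρ k := hx
              simpa using hx
            · simp [hkl, ← hε, OType.bot]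
          · rw [← hε]; exact hx
          · rw [← hε]; exact hxk
          · simp
        · refine le_antisymm (he.le_of_forall_isCMI fun x hx hxk =>
            sInf_le ⟨_, ⟨k, x, ?_, ?_, rfl⟩, ?_⟩) (le_sInf ?_)
          · rw [← hε]; exact hx
          · rw [← hε]; exact hxk
          · simp
          · rintro _ ⟨_, ⟨l, x, -, hx, rfl⟩, rfl⟩
            by_cases hkl : k = l
            · subst hkl
              rw [← hε] at hx
              have hx : ρ k ≤ x := hx
              simpa using hx
            · simp [hkl, ← hε, OType.bot]
      exact key _ rfl
  -- `B` is directed: pre-fixed points of `f(·, o)` are closed under binary joins, and `j` is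
  -- join-prime. By the contradiction hypothesis `B` supplies an upper bound for `f` at each tuple
  -- of `T`.
  let B : Set A := {b | f (Fin.cons (e b) o) ≤ e b ∧ ¬ j ≤ e b}
  have hB : DirectedOn (· ≤ ·) B := by
    rintro b ⟨hb, hjb⟩ c ⟨hc, hjc⟩
    refine ⟨b ⊔ c, ⟨?_, fun hle => ?_⟩, le_sup_left, le_sup_right⟩
    · rw [map_sup, hjoin]
      exact sup_le_sup hb hc
    · rw [map_sup] at hle
      exact (hj.le_or_le hle).elim hjb hjc
  have hB₀ : B.Nonempty := ⟨⊥, by rw [map_bot, hbot], by rw [map_bot]; exact hj.not_le_bot⟩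
  have hle : f (Fin.cons ⊥ ρ) ≤ sSup (e '' B) := by
    rw [← hT, hf T]
    refine sSup_le ?_
    rintro _ ⟨_, ⟨k, x, hx, hxk, rfl⟩, rfl⟩
    have hnle := hcon k x hx hxk
    simp only [le_sInf_iff, not_forall] at hnle
    obtain ⟨_, ⟨b, rfl, hb⟩, hjb⟩ := hnle
    refine le_trans ((hmono bot_le fun l => OType.le_refl _ _).trans hb)
      (le_sSup (Set.mem_image_of_mem e ⟨?_, hjb⟩))
    refine (hmono le_rfl fun l => ?_).trans hb
    exact OType.bot_le _ _
  obtain ⟨a, ha⟩ := hρ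
  rw [← ha] at hle
  -- As `f(⊥, ρ)` is in `A`, compactness puts it below one `b` in `B`. Then `hsplit` makes `b` a
  -- pre-fixed point for `ρ`, so `j ≤ e b`, against the choice of `B`.
  obtain ⟨b, ⟨hb, hjb⟩, hab⟩ := he.exists_le_mem hB hB₀ (IsClosedElem.map e a) hle
  refine hjb (h.trans (sInf_le ⟨b, rfl, ?_⟩))
  rw [hsplit, ← ha]
  exact sup_le hab hb

/-- The semantic content of the fixed point approximation rule for `ν*`. -/
theorem exists_isIrr_sSup_le (he : IsCanonicalExtension e) {n : ℕ} {τ : Fin n → OType}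
    {f : (Fin (n + 1) → C) → C} (hf : CompletelyMeetPreserving (Fin.cons .one τ) f)
    {ρ : Fin n → C} (hρ : f (Fin.cons ⊤ ρ) ∈ Set.range e) {m : C} (hm : IsCMI m)
    (h : sSup {c | ∃ a : A, c = e a ∧ e a ≤ f (Fin.cons (e a) ρ)} ≤ m) :
    ∃ k, ∃ x : C, (τ k).IsIrr (C := Cᵒᵈ) x ∧ (τ k).le (C := Cᵒᵈ) x (ρ k) ∧
      sSup {c | ∃ a : A, c = e a ∧
        e a ≤ f (Fin.cons (e a) fun l => if l = k then x else (τ l).bot (C := Cᵒᵈ))} ≤ m :=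
  exists_isIrr_le_sInf (A := Aᵒᵈ) (C := Cᵒᵈ) he.dual hf.dual hρ hm h

end FixedPointApproximation

/-! ## Soundness of the rules -/

section Soundness

variable {A : Type u} [ModalBiheytingAlgebra A] {C : Type v} [CompletelyDistribLattice C]
  {e : BoundedLatticeHom A C}

omit [CompletelyDistribLattice C] in
theorem Valuation.setProp_self (V : Valuation C) (p : ℕ) : V.setProp p (V.prop p) = V := by
  simp [Valuation.setProp]

namespace Ineq

theorem holds_setProp {x : Ineq} {p : ℕ} (h : p ∉ x.props) {V : Valuation C} {c : C} :
    x.Holds e (V.setProp p c) ↔ x.Holds e V := by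
  rw [Holds, Holds, XTerm.eval_setProp fun h' => h (Or.inl h'),
    XTerm.eval_setProp fun h' => h (Or.inr h')]

theorem holds_setNom {x : Ineq} {i : ℕ} (h : i ∉ x.lhs.noms ∪ x.rhs.noms) {V : Valuation C}
    {c : C} : x.Holds e (V.setNom i c) ↔ x.Holds e V := by
  rw [Holds, Holds, XTerm.eval_setNom fun h' => h (Or.inl h'),
    XTerm.eval_setNom fun h' => h (Or.inr h')]

theorem holds_setConom {x : Ineq} {m : ℕ} (h : m ∉ x.lhs.conoms ∪ x.rhs.conoms) {V : Valuation C}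
    {c : C} : x.Holds e (V.setConom m c) ↔ x.Holds e V := by
  rw [Holds, Holds, XTerm.eval_setConom fun h' => h (Or.inl h'),
    XTerm.eval_setConom fun h' => h (Or.inr h')]

theorem holds_substProp {x : Ineq} {p : ℕ} {α : XTerm 0} {V : Valuation C} :
    (x.lhs.substProp p α ≼ x.rhs.substProp p α).Holds e V ↔
      x.Holds e (V.setProp p (α.eval e V Fin.elim0)) := by
  rw [Holds, Holds, XTerm.eval_substProp, XTerm.eval_substProp]

end Ineq

namespace QIneq

/-- Soundness in contrapositive form: a refutation of `q'` is turned into one of `q`, possibly after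
reassigning the variable or fresh name that a rule eliminates or introduces. -/
theorem AdmValid.of_forall_exists {q q' : QIneq} (hq : q.AdmValid e)
    (h : ∀ V : Valuation C, V.IsAdmissible e → (∀ x ∈ q'.ants, x.Holds e V) →
      ∃ W : Valuation C, W.IsAdmissible e ∧ (∀ x ∈ q.ants, x.Holds e W) ∧
        (q.con.Holds e W → q'.con.Holds e V)) : q'.AdmValid e := fun V hV hx => by
  obtain ⟨W, hW, hW', hcon⟩ := h V hV hx
  exact hcon (hq W hW hW')

theorem admValid_congr {Γ Γ' : List Ineq} {c : Ineq}
    (h : ∀ V : Valuation C, V.IsAdmissible e →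
      ((∀ x ∈ Γ, x.Holds e V) ↔ ∀ x ∈ Γ', x.Holds e V)) :
    AdmValid e ⟨Γ, c⟩ ↔ AdmValid e ⟨Γ', c⟩ :=
  forall₂_congr fun V hV => imp_congr_left (h V hV)

theorem admValid_cons_congr {x y : Ineq} {Γ : List Ineq} {c : Ineq}
    (h : ∀ V : Valuation C, V.IsAdmissible e → (x.Holds e V ↔ y.Holds e V)) :
    AdmValid e ⟨x :: Γ, c⟩ ↔ AdmValid e ⟨y :: Γ, c⟩ :=
  admValid_congr fun V hV => by
    simp only [List.forall_mem_cons, h V hV]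

theorem admValid_cons_cons_congr {x y z : Ineq} {Γ : List Ineq} {c : Ineq}
    (h : ∀ V : Valuation C, V.IsAdmissible e → (x.Holds e V ↔ y.Holds e V ∧ z.Holds e V)) :
    AdmValid e ⟨x :: Γ, c⟩ ↔ AdmValid e ⟨y :: z :: Γ, c⟩ :=
  admValid_congr fun V hV => by
    simp only [List.forall_mem_cons, h V hV, and_assoc]

end QIneq

/-! ### Approximation rules -/

namespace IsCanonicalExtension

theorem exists_isCJI_le_diaC (he : IsCanonicalExtension e) {j c : C} (hj : IsCJI j)
    (h : j ≤ diaC e c) : ∃ i, IsCJI i ∧ i ≤ c ∧ j ≤ diaC e i := by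
  rw [he.eq_sSup_isCJI c, he.diaC_sSup] at h
  obtain ⟨_, ⟨i, ⟨hi, hic⟩, rfl⟩, h'⟩ := hj.exists_le h
  exact ⟨i, hi, hic, h'⟩

theorem exists_isCMI_boxC_le (he : IsCanonicalExtension e) {m c : C} (hm : IsCMI m)
    (h : boxC e c ≤ m) : ∃ n, IsCMI n ∧ c ≤ n ∧ boxC e n ≤ m := by
  simp only [boxC_eq_diaC_dual] at h ⊢
  exact exists_isCJI_le_diaC (A := Aᵒᵈ) (C := Cᵒᵈ) he.dual hm h

/-- Decomposing `c` into join-irreducibles and `d` into meet-irreducibles turns the implication into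
a meet; complete meet-primeness of `m` selects one member, once for each argument. -/
theorem exists_isCJI_isCMI_himp_le (he : IsCanonicalExtension e) {m c d : C} (hm : IsCMI m)
    (h : c ⇨ d ≤ m) : ∃ j n, IsCJI j ∧ IsCMI n ∧ j ≤ c ∧ d ≤ n ∧ j ⇨ n ≤ m := by
  rw [he.eq_sSup_isCJI c, sSup_eq_iSup', iSup_himp_eq] at h
  obtain ⟨_, ⟨⟨j, hj, hjc⟩, rfl⟩, h⟩ := hm.exists_le h
  simp only at h
  rw [he.eq_sInf_isCMI d, sInf_eq_iInf', himp_iInf_eq] at h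
  obtain ⟨_, ⟨⟨n, hn, hdn⟩, rfl⟩, h⟩ := hm.exists_le h
  exact ⟨j, n, hj, hn, hjc, hdn, h⟩

theorem exists_isCJI_isCMI_le_sdiff (he : IsCanonicalExtension e) {i c d : C} (hi : IsCJI i)
    (h : i ≤ c \ d) : ∃ n j, IsCMI n ∧ IsCJI j ∧ d ≤ n ∧ j ≤ c ∧ i ≤ j \ n :=
  exists_isCJI_isCMI_himp_le (A := Aᵒᵈ) (C := Cᵒᵈ) he.dual hi h

end IsCanonicalExtension

/-! ### Ackermann rules -/

/-- Both Ackermann rules at once: `s` tells whether `δ` bounds `p` from below or above. Eliminating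
`p` uses monotonicity under the same assignment; restoring `p` needs a value in `A`, since that of
`δ` may lie outside it. -/
theorem admValid_iff_of_ackermann (he : IsCanonicalExtension e) {p : ℕ} {s : Bool} {δ : XTerm 0}
    (hδ : p ∉ δ.props) (hδs : (s = true ∧ δ.SynClosed) ∨ (s = false ∧ δ.SynOpen))
    {Δ B Γ : List Ineq} {c : Ineq}
    (hΔ : ∀ V : Valuation C, (∀ x ∈ Δ, x.Holds e V) ↔
      SignedLE s (δ.eval e V Fin.elim0) (V.prop p))
    (hl : ∀ x ∈ B, x.lhs.SynClosed ∧ x.lhs.SignedProp s p)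
    (hr : ∀ x ∈ B, x.rhs.SynOpen ∧ x.rhs.SignedProp (!s) p)
    (hΓ : ∀ x ∈ Γ, p ∉ x.props) (hc : p ∉ c.props) :
    QIneq.AdmValid e ⟨Δ ++ B ++ Γ, c⟩ ↔ QIneq.AdmValid e
      ⟨B.map (fun x => x.lhs.substProp p δ ≼ x.rhs.substProp p δ) ++ Γ, c⟩ := by
  constructor
  · refine fun hq => hq.of_forall_exists fun V hV hx => ?_
    simp only [List.forall_mem_append, List.forall_mem_map, Ineq.holds_substProp] at hx
    obtain ⟨a, ha, hB⟩ := exists_forall_eval_le he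
      (XTerm.isSignedClosed_eval he hV hδs hδ) hV B hl hr hx.1
    refine ⟨_, hV.setProp p a, ?_, (Ineq.holds_setProp hc).1⟩
    simp only [List.forall_mem_append]
    refine ⟨⟨(hΔ _).2 ?_, hB⟩, fun x hxΓ => (Ineq.holds_setProp (hΓ x hxΓ)).2 (hx.2 x hxΓ)⟩
    rw [XTerm.eval_setProp hδ]
    simpa [Valuation.setProp] using ha
  · refine fun hq => hq.of_forall_exists fun V hV hx => ⟨V, hV, ?_, id⟩
    simp only [List.forall_mem_append] at hx
    simp only [List.forall_mem_append, List.forall_mem_map, Ineq.holds_substProp]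
    refine ⟨fun x hxB => ?_, hx.2⟩
    have hle := (hΔ V).1 hx.1.1
    have h := hx.1.2 x hxB
    rw [← V.setProp_self p] at h
    exact (XTerm.eval_mono_prop he (hl x hxB).2 hle _).trans
      (h.trans (XTerm.eval_mono_prop he (hr x hxB).2 (signedLE_not.2 hle) _))

theorem OrdStep.admValid_iff (he : IsCanonicalExtension e) {q q' : QIneq} (h : OrdStep q q') :
    q.AdmValid e ↔ q'.AdmValid e := by
  have sub : ∀ {S T : Set ℕ} {i : ℕ}, i ∉ S ∪ T → i ∉ S ∧ i ∉ T := fun h =>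
    ⟨fun h' => h (Or.inl h'), fun h' => h (Or.inr h')⟩
  cases h with
  | rearrange h => exact QIneq.admValid_congr fun V _ => forall_congr' fun x => by rw [h]
  | subLR => exact QIneq.admValid_cons_congr fun V _ => sdiff_le_iff
  | impRR => exact QIneq.admValid_cons_congr fun V _ => le_himp_iff
  | conjLR => exact QIneq.admValid_cons_congr fun V _ => le_himp_iff.symm
  | conjLR' => exact QIneq.admValid_cons_congr fun V _ => le_himp_iff'.symm
  | disjRR => exact QIneq.admValid_cons_congr fun V _ => sdiff_le_iff.symm
  | disjRR' => exact QIneq.admValid_cons_congr fun V _ => sdiff_le_iff'.symm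
  | disjLA => exact QIneq.admValid_cons_cons_congr fun V _ => sup_le_iff
  | conjRA => exact QIneq.admValid_cons_cons_congr fun V _ => le_inf_iff
  | diaLA => exact QIneq.admValid_cons_congr fun V _ => he.gc_diaC_bboxC _ _
  | boxRA => exact QIneq.admValid_cons_congr fun V _ => (he.gc_bdiaC_boxC _ _).symm
  | boxAppr ψ m n Γ c hn =>
    have hn' : ∀ x ∈ c :: (.box ψ ≼ .conom m) :: Γ, n ∉ x.lhs.conoms ∪ x.rhs.conoms :=
      fun x hx h => hn ⟨x, hx, h⟩
    simp only [List.forall_mem_cons] at hn'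
    obtain ⟨hc, hx, hΓ⟩ := hn'
    obtain ⟨hψ, hm⟩ := sub hx
    have hmn : m ≠ n := fun h => hm h.symm
    constructor
    · refine fun hq => hq.of_forall_exists fun V hV hx => ⟨V, hV, ?_, id⟩
      simp only [List.forall_mem_cons] at hx ⊢
      exact ⟨(he.boxC_mono hx.2.1).trans hx.1, hx.2.2⟩
    · refine fun hq => hq.of_forall_exists fun V hV hx => ?_
      simp only [List.forall_mem_cons] at hx
      -- The witness becomes the value of the fresh co-nominal; freshness keeps all other
      -- inequalities unchanged. The other approximation rules below follow the same pattern.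
      obtain ⟨x, hxm, hψx, hxb⟩ := he.exists_isCMI_boxC_le (hV.conom m) hx.1
      refine ⟨_, hV.setConom n hxm, ?_, (Ineq.holds_setConom hc).1⟩
      simp only [List.forall_mem_cons]
      refine ⟨?_, ?_, fun y hy => (Ineq.holds_setConom (hΓ y hy)).2 (hx.2 y hy)⟩
      · simpa [Ineq.Holds, XTerm.eval, Valuation.setConom, hmn] using hxb
      · have h := hψx
        rw [← XTerm.eval_setConom (t := ψ) hψ V x] at h
        simpa [Ineq.Holds, XTerm.eval, Valuation.setConom] using h
  | diaAppr ψ j i Γ c hi =>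
    have hi' : ∀ x ∈ c :: (.nom j ≼ .dia ψ) :: Γ, i ∉ x.lhs.noms ∪ x.rhs.noms :=
      fun x hx h => hi ⟨x, hx, h⟩
    simp only [List.forall_mem_cons] at hi'
    obtain ⟨hc, hx, hΓ⟩ := hi'
    obtain ⟨hj, hψ⟩ := sub hx
    have hji : j ≠ i := fun h => hj h.symm
    constructor
    · refine fun hq => hq.of_forall_exists fun V hV hx => ⟨V, hV, ?_, id⟩
      simp only [List.forall_mem_cons] at hx ⊢
      exact ⟨hx.1.trans (he.diaC_mono hx.2.1), hx.2.2⟩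
    · refine fun hq => hq.of_forall_exists fun V hV hx => ?_
      simp only [List.forall_mem_cons] at hx
      obtain ⟨x, hxi, hψx, hxd⟩ := he.exists_isCJI_le_diaC (hV.nom j) hx.1
      refine ⟨_, hV.setNom i hxi, ?_, (Ineq.holds_setNom hc).1⟩
      simp only [List.forall_mem_cons]
      refine ⟨?_, ?_, fun y hy => (Ineq.holds_setNom (hΓ y hy)).2 (hx.2 y hy)⟩
      · simpa [Ineq.Holds, XTerm.eval, Valuation.setNom, hji] using hxd
      · have h := hψx
        rw [← XTerm.eval_setNom (t := ψ) hψ V x] at h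
        simpa [Ineq.Holds, XTerm.eval, Valuation.setNom] using h
  | impAppr χ φ m j n Γ c hj hn =>
    have hn' : ∀ x ∈ c :: (.imp χ φ ≼ .conom m) :: Γ, n ∉ x.lhs.conoms ∪ x.rhs.conoms :=
      fun x hx h => hn ⟨x, hx, h⟩
    have hj' : ∀ x ∈ c :: (.imp χ φ ≼ .conom m) :: Γ, j ∉ x.lhs.noms ∪ x.rhs.noms :=
      fun x hx h => hj ⟨x, hx, h⟩
    simp only [List.forall_mem_cons] at hn' hj'
    obtain ⟨hcn, hxn, hΓn⟩ := hn'
    obtain ⟨hcj, hxj, hΓj⟩ := hj'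
    obtain ⟨hχφn, hm⟩ := sub hxn
    obtain ⟨hχn, hφn⟩ := sub hχφn
    obtain ⟨hχj, hφj⟩ := sub (sub hxj).1
    have hmn : m ≠ n := fun h => hm h.symm
    constructor
    · refine fun hq => hq.of_forall_exists fun V hV hx => ⟨V, hV, ?_, id⟩
      simp only [List.forall_mem_cons] at hx ⊢
      exact ⟨(himp_le_himp hx.2.1 hx.2.2.1).trans hx.1, hx.2.2.2⟩
    · refine fun hq => hq.of_forall_exists fun V hV hx => ?_
      simp only [List.forall_mem_cons] at hx
      obtain ⟨x, y, hxj, hyn, hxχ, hφy, hxy⟩ := he.exists_isCJI_isCMI_himp_le (hV.conom m) hx.1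
      refine ⟨_, (hV.setNom j hxj).setConom n hyn, ?_,
        fun h => (Ineq.holds_setNom hcj).1 ((Ineq.holds_setConom hcn).1 h)⟩
      simp only [List.forall_mem_cons]
      refine ⟨?_, ?_, ?_, fun y hy =>
        (Ineq.holds_setConom (hΓn y hy)).2 ((Ineq.holds_setNom (hΓj y hy)).2 (hx.2 y hy))⟩
      · simpa [Ineq.Holds, XTerm.eval, Valuation.setNom, Valuation.setConom, hmn] using hxy
      · have h := hxχ
        rw [← XTerm.eval_setNom hχj V x, ← XTerm.eval_setConom hχn (V.setNom j x) y] at h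
        simpa [Ineq.Holds, XTerm.eval, Valuation.setNom, Valuation.setConom] using h
      · have h := hφy
        rw [← XTerm.eval_setNom hφj V x, ← XTerm.eval_setConom hφn (V.setNom j x) y] at h
        simpa [Ineq.Holds, XTerm.eval, Valuation.setNom, Valuation.setConom] using h
  | subAppr χ φ i j n Γ c hj hn =>
    have hn' : ∀ x ∈ c :: (.nom i ≼ .sub χ φ) :: Γ, n ∉ x.lhs.conoms ∪ x.rhs.conoms :=
      fun x hx h => hn ⟨x, hx, h⟩
    have hj' : ∀ x ∈ c :: (.nom i ≼ .sub χ φ) :: Γ, j ∉ x.lhs.noms ∪ x.rhs.noms :=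
      fun x hx h => hj ⟨x, hx, h⟩
    simp only [List.forall_mem_cons] at hn' hj'
    obtain ⟨hcn, hxn, hΓn⟩ := hn'
    obtain ⟨hcj, hxj, hΓj⟩ := hj'
    obtain ⟨hi, hχφj⟩ := sub hxj
    obtain ⟨hχj, hφj⟩ := sub hχφj
    obtain ⟨hχn, hφn⟩ := sub (sub hxn).2
    have hij : i ≠ j := fun h => hi h.symm
    constructor
    · refine fun hq => hq.of_forall_exists fun V hV hx => ⟨V, hV, ?_, id⟩
      simp only [List.forall_mem_cons] at hx ⊢
      exact ⟨hx.1.trans (sdiff_le_sdiff hx.2.1 hx.2.2.1), hx.2.2.2⟩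
    · refine fun hq => hq.of_forall_exists fun V hV hx => ?_
      simp only [List.forall_mem_cons] at hx
      obtain ⟨y, x, hyn, hxj, hφy, hxχ, hxy⟩ := he.exists_isCJI_isCMI_le_sdiff (hV.nom i) hx.1
      refine ⟨_, (hV.setNom j hxj).setConom n hyn, ?_,
        fun h => (Ineq.holds_setNom hcj).1 ((Ineq.holds_setConom hcn).1 h)⟩
      simp only [List.forall_mem_cons]
      refine ⟨?_, ?_, ?_, fun y hy =>
        (Ineq.holds_setConom (hΓn y hy)).2 ((Ineq.holds_setNom (hΓj y hy)).2 (hx.2 y hy))⟩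
      · simpa [Ineq.Holds, XTerm.eval, Valuation.setNom, Valuation.setConom, hij] using hxy
      · have h := hxχ
        rw [← XTerm.eval_setNom hχj V x, ← XTerm.eval_setConom hχn (V.setNom j x) y] at h
        simpa [Ineq.Holds, XTerm.eval, Valuation.setNom, Valuation.setConom] using h
      · have h := hφy
        rw [← XTerm.eval_setNom hφj V x, ← XTerm.eval_setConom hφn (V.setNom j x) y] at h
        simpa [Ineq.Holds, XTerm.eval, Valuation.setNom, Valuation.setConom] using h
  | rightAckermann p αs B Γ c hα hβ hγ hΓ hc =>
    refine admValid_iff_of_ackermann he (s := true)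
      (XTerm.props_bigDisj fun α h => (hα α h).1)
      (Or.inl ⟨rfl, XTerm.synClosed_bigDisj fun α h => (hα α h).2⟩) (fun V => ?_)
      (fun x hx => (hβ x hx).symm) (fun x hx => (hγ x hx).symm) hΓ hc
    rw [List.forall_mem_map]
    exact XTerm.eval_bigDisj_le.symm
  | leftAckermann p αs B Γ c hα hβ hγ hΓ hc =>
    refine admValid_iff_of_ackermann he (s := false)
      (XTerm.props_bigConj fun α h => (hα α h).1)
      (Or.inr ⟨rfl, XTerm.synOpen_bigConj fun α h => (hα α h).2⟩) (fun V => ?_)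
      (fun x hx => (hγ x hx).symm) (fun x hx => (hβ x hx).symm) hΓ hc
    rw [List.forall_mem_map]
    exact XTerm.le_eval_bigConj.symm

/-! ### Fixed point approximation rules -/

/-- Change the value of a nominal for the type `1`, of a co-nominal for the type `∂`. -/
def Valuation.setNomT (V : Valuation C) : OType → ℕ → C → Valuation C
  | .one, y, c => V.setNom y c
  | .dual, y, c => V.setConom y c

omit [CompletelyDistribLattice C] in
theorem Valuation.prop_setNomT (V : Valuation C) (ε : OType) (y : ℕ) (c : C) :
    (V.setNomT ε y c).prop = V.prop := by
  cases ε <;> rfl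

theorem Valuation.IsAdmissible.setNomT {V : Valuation C} (hV : V.IsAdmissible e) {ε : OType}
    (y : ℕ) {x : C} (hx : ε.IsIrr x) : (V.setNomT ε y x).IsAdmissible e := by
  cases ε
  · exact hV.setNom y hx
  · exact hV.setConom y hx

theorem eval_nomT_setNomT {V : Valuation C} {ε : OType} {y : ℕ} {x : C} :
    (nomT ε y).eval e (V.setNomT ε y x) Fin.elim0 = x := by
  cases ε <;> simp [nomT, XTerm.eval, Valuation.setNomT, Valuation.setNom, Valuation.setConom]

theorem eval_botT {V : Valuation C} {ε : OType} : (botT ε).eval e V Fin.elim0 = ε.bot := by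
  cases ε <;> rfl

theorem holds_leT {V : Valuation C} {ε : OType} {s t : XTerm 0} :
    (leT ε s t).Holds e V ↔ ε.le (s.eval e V Fin.elim0) (t.eval e V Fin.elim0) := by
  cases ε <;> rfl

theorem holds_setNomT {q : QIneq} {ε : OType} {y : ℕ} (hy : nomFresh q ε y) {x : Ineq}
    (hx : x ∈ q.con :: q.ants) {V : Valuation C} {c : C} :
    x.Holds e (V.setNomT ε y c) ↔ x.Holds e V := by
  cases ε
  · exact Ineq.holds_setNom fun h => hy ⟨x, hx, h⟩
  · exact Ineq.holds_setConom fun h => hy ⟨x, hx, h⟩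

omit [CompletelyDistribLattice C] in
theorem nom_setNomT {q : QIneq} {ε : OType} {y i : ℕ} (hy : nomFresh q ε y) {x : Ineq}
    (hx : x ∈ q.ants) (hi : x.lhs = .nom i) {V : Valuation C} {c : C} :
    (V.setNomT ε y c).nom i = V.nom i := by
  cases ε
  · refine Function.update_of_ne (fun h => hy ⟨x, List.mem_cons_of_mem _ hx, Or.inl ?_⟩) _ _
    rw [hi]
    exact h.symm
  · rfl

theorem OType.le_ite_bot {n : ℕ} {τ : Fin n → OType} {k : Fin n} {x : C} {ρ : Fin n → C}
    (h : (τ k).le x (ρ k)) (l : Fin n) : (τ l).le (if l = k then x else (τ l).bot) (ρ l) := by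
  by_cases hl : l = k
  · subst hl
    simpa using h
  · simpa [hl] using OType.bot_le _ _

theorem CompletelyJoinPreserving.sInf_mono {n : ℕ} {τ : Fin n → OType}
    {f : (Fin (n + 1) → C) → C} (hf : CompletelyJoinPreserving (Fin.cons .one τ) f)
    {σ ρ : Fin n → C} (h : ∀ k, (τ k).le (σ k) (ρ k)) :
    sInf {c | ∃ a : A, c = e a ∧ f (Fin.cons (e a) σ) ≤ e a} ≤
      sInf {c | ∃ a : A, c = e a ∧ f (Fin.cons (e a) ρ) ≤ e a} := by
  refine sInf_le_sInf ?_
  rintro _ ⟨a, rfl, ha⟩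
  refine ⟨a, rfl, le_trans (hf.mono fun k => ?_) ha⟩
  refine Fin.cases le_rfl (fun k => ?_) k
  simpa using h k

theorem eval_mu_subst {n : ℕ} (ψ : Term (n + 1)) (F : Fin n → XTerm 0) (V : Valuation C) :
    ((Term.mu ψ).star.subst F).eval e V Fin.elim0 = sInf {c | ∃ a : A, c = e a ∧
      ψ.star.eval e V (Fin.cons (e a) fun k => (F k).eval e V Fin.elim0) ≤ e a} :=
  XTerm.eval_subst _ _ _ _

theorem eval_nu_subst {n : ℕ} (ψ : Term (n + 1)) (F : Fin n → XTerm 0) (V : Valuation C) :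
    ((Term.nu ψ).star.subst F).eval e V Fin.elim0 = sSup {c | ∃ a : A, c = e a ∧
      e a ≤ ψ.star.eval e V (Fin.cons (e a) fun k => (F k).eval e V Fin.elim0)} :=
  XTerm.eval_subst _ _ _ _

theorem eval_nomTuple {n : ℕ} {τ : Fin n → OType} {k : Fin n} {y : ℕ} {V : Valuation C} :
    (fun l => (nomTuple τ k y l).eval e V Fin.elim0) =
      fun l => if l = k then (nomT (τ k) y).eval e V Fin.elim0 else (τ l).bot := by
  funext l
  by_cases h : l = k <;> simp [nomTuple, h, eval_botT]

/-- A refutation of one of the split quasi-inequalities refutes the original by monotonicity.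
Conversely, a refutation of the original determines a coordinate and an irreducible, hence which of
the split ones fails. -/
theorem admValid_muApprox (he : IsCanonicalExtension e) (hA : IsSecondKind A) {n : ℕ}
    {τ : Fin n → OType} {ψ : Term (n + 1)} {φ : Fin n → Term 0} {i : ℕ} {y : Fin n → ℕ}
    {Γ : List Ineq} {c : Ineq} (hψ : ψ.WF) (hφ : ∀ k, (φ k).WF)
    (hpres : ∀ V : Valuation C, CompletelyJoinPreserving (Fin.cons .one τ) (ψ.star.eval e V))
    (hfresh : ∀ k, nomFresh
      ⟨(.nom i ≼ (Term.mu ψ).star.subst fun l => (φ l).star) :: Γ, c⟩ (τ k) (y k)) :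
    QIneq.AdmValid e ⟨(.nom i ≼ (Term.mu ψ).star.subst fun l => (φ l).star) :: Γ, c⟩ ↔
      ∀ k : Fin n, QIneq.AdmValid e
        ⟨(.nom i ≼ (Term.mu ψ).star.subst (nomTuple τ k (y k))) ::
            leT (τ k) (nomT (τ k) (y k)) (φ k).star :: Γ, c⟩ := by
  constructor
  · refine fun hq k => hq.of_forall_exists fun V hV hx => ⟨V, hV, ?_, id⟩
    simp only [List.forall_mem_cons, holds_leT] at hx ⊢
    refine ⟨hx.1.trans ?_, hx.2.2⟩
    simp only [eval_mu_subst, eval_nomTuple]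
    exact (hpres V).sInf_mono (OType.le_ite_bot hx.2.1)
  · intro hq V hV hx
    have hx₁ : V.nom i ≤ ((Term.mu ψ).star.subst fun l => (φ l).star).eval e V Fin.elim0 :=
      hx _ List.mem_cons_self
    rw [eval_mu_subst] at hx₁
    obtain ⟨k, x, hirr, hxk, hle⟩ := exists_isIrr_le_sInf he (hpres V)
      -- The body at `⊥` and the values of the sentences stays in `A`, which licenses the
      -- compactness argument.
      (Term.eval_star_mem_range he hA hV.prop hψ fun l => by
        refine Fin.cases ⟨⊥, map_bot e⟩ (fun l => ?_) l
        exact Term.eval_star_mem_range he hA hV.prop (hφ l) fun l => l.elim0) (hV.nom i) hx₁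
    have hW := hV.setNomT (y k) hirr
    refine (holds_setNomT (hfresh k) List.mem_cons_self).1 (hq k _ hW ?_)
    simp only [List.forall_mem_cons, holds_leT, eval_nomT_setNomT]
    refine ⟨?_, ?_, fun z hz => ?_⟩
    · simp only [Ineq.Holds, eval_mu_subst, eval_nomTuple, eval_nomT_setNomT, XTerm.eval]
      rw [nom_setNomT (hfresh k) List.mem_cons_self rfl]
      simpa only [ψ.eval_star_congr (V.prop_setNomT (τ k) (y k) x)] using hle
    · rwa [Term.eval_star_congr _ (V.prop_setNomT (τ k) (y k) x)]
    · exact (holds_setNomT (hfresh k) (List.mem_cons_of_mem _ (List.mem_cons_of_mem _ hz))).2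
        (hx z (List.mem_cons_of_mem _ hz))

namespace OType

/-- Exchange `1` and `∂`. -/
def flip : OType → OType
  | one => dual
  | dual => one

theorem isIrr_dual {ε : OType} {x : C} : ε.IsIrr (C := Cᵒᵈ) x ↔ ε.flip.IsIrr x := by
  cases ε <;> rfl

theorem le_dual {ε : OType} {x y : C} : ε.le (C := Cᵒᵈ) x y ↔ ε.flip.le x y := by
  cases ε <;> rfl

theorem bot_dual {ε : OType} : (ε.bot (C := Cᵒᵈ) : C) = ε.flip.bot (C := C) := by
  cases ε <;> rfl

end OType

theorem conomT_eq (ε : OType) (y : ℕ) : conomT ε y = nomT ε.flip y := by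
  cases ε <;> rfl

theorem conomTuple_eq {n : ℕ} (τ : Fin n → OType) (k : Fin n) (y : ℕ) :
    conomTuple τ k y = nomTuple (fun l => (τ l).flip) k y := by
  funext l
  unfold conomTuple nomTuple
  rw [conomT_eq]
  have h : topT (τ l) = botT (τ l).flip := by cases τ l <;> rfl
  rw [h]

theorem leT_flip (ε : OType) (s t : XTerm 0) : leT ε s t = leT ε.flip t s := by
  cases ε <;> rfl

theorem conomFresh_iff {q : QIneq} {ε : OType} {y : ℕ} :
    conomFresh q ε y ↔ nomFresh q ε.flip y := by
  cases ε <;> rfl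

theorem CompletelyMeetPreserving.sSup_mono {n : ℕ} {τ : Fin n → OType}
    {f : (Fin (n + 1) → C) → C} (hf : CompletelyMeetPreserving (Fin.cons .one τ) f)
    {σ ρ : Fin n → C} (h : ∀ k, (τ k).flip.le (σ k) (ρ k)) :
    sSup {c | ∃ a : A, c = e a ∧ e a ≤ f (Fin.cons (e a) ρ)} ≤
      sSup {c | ∃ a : A, c = e a ∧ e a ≤ f (Fin.cons (e a) σ)} :=
  hf.dual.sInf_mono (A := Aᵒᵈ) (C := Cᵒᵈ) (e := BoundedLatticeHom.dual e)
    fun k => OType.le_dual.2 (h k)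

omit [CompletelyDistribLattice C] in
theorem conom_setNomT {q : QIneq} {ε : OType} {y m : ℕ} (hy : nomFresh q ε y) {x : Ineq}
    (hx : x ∈ q.ants) (hm : x.rhs = .conom m) {V : Valuation C} {c : C} :
    (V.setNomT ε y c).conom m = V.conom m := by
  cases ε
  · rfl
  · refine Function.update_of_ne (fun h => hy ⟨x, List.mem_cons_of_mem _ hx, Or.inr ?_⟩) _ _
    rw [hm]
    exact h.symm

theorem admValid_nuApprox (he : IsCanonicalExtension e) (hA : IsSecondKind A) {n : ℕ}
    {τ : Fin n → OType} {φ : Term (n + 1)} {ψ : Fin n → Term 0} {m : ℕ} {y : Fin n → ℕ}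
    {Γ : List Ineq} {c : Ineq} (hφ : φ.WF) (hψ : ∀ k, (ψ k).WF)
    (hpres : ∀ V : Valuation C, CompletelyMeetPreserving (Fin.cons .one τ) (φ.star.eval e V))
    (hfresh : ∀ k, conomFresh
      ⟨((Term.nu φ).star.subst (fun l => (ψ l).star) ≼ .conom m) :: Γ, c⟩ (τ k) (y k)) :
    QIneq.AdmValid e ⟨((Term.nu φ).star.subst (fun l => (ψ l).star) ≼ .conom m) :: Γ, c⟩ ↔
      ∀ k : Fin n, QIneq.AdmValid e
        ⟨((Term.nu φ).star.subst (conomTuple τ k (y k)) ≼ .conom m) ::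
            leT (τ k) (ψ k).star (conomT (τ k) (y k)) :: Γ, c⟩ := by
  -- Dualising the lattice exchanges nominals and co-nominals, so flipping the order type brings the
  -- syntax of the rule into the form of its `μ*` counterpart.
  simp only [conomFresh_iff] at hfresh
  simp only [conomTuple_eq, conomT_eq, leT_flip (τ _)]
  constructor
  · refine fun hq k => hq.of_forall_exists fun V hV hx => ⟨V, hV, ?_, id⟩
    simp only [List.forall_mem_cons, holds_leT] at hx ⊢
    refine ⟨le_trans ?_ hx.1, hx.2.2⟩
    simp only [eval_nu_subst, eval_nomTuple]
    exact (hpres V).sSup_mono (OType.le_ite_bot hx.2.1)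
  · intro hq V hV hx
    have hx₁ : ((Term.nu φ).star.subst fun l => (ψ l).star).eval e V Fin.elim0 ≤ V.conom m :=
      hx _ List.mem_cons_self
    rw [eval_nu_subst] at hx₁
    obtain ⟨k, x, hirr, hxk, hle⟩ := exists_isIrr_sSup_le he (hpres V)
      (Term.eval_star_mem_range he hA hV.prop hφ fun l => by
        refine Fin.cases ⟨⊤, map_top e⟩ (fun l => ?_) l
        exact Term.eval_star_mem_range he hA hV.prop (hψ l) fun l => l.elim0) (hV.conom m) hx₁
    simp only [OType.bot_dual] at hle
    have hW := hV.setNomT (y k) (OType.isIrr_dual.1 hirr)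
    refine (holds_setNomT (hfresh k) List.mem_cons_self).1 (hq k _ hW ?_)
    simp only [List.forall_mem_cons, holds_leT, eval_nomT_setNomT]
    refine ⟨?_, ?_, fun z hz => ?_⟩
    · simp only [Ineq.Holds, eval_nu_subst, eval_nomTuple, eval_nomT_setNomT, XTerm.eval]
      rw [conom_setNomT (hfresh k) List.mem_cons_self rfl]
      simpa only [φ.eval_star_congr (V.prop_setNomT (τ k).flip (y k) x)] using hle
    · rw [Term.eval_star_congr _ (V.prop_setNomT (τ k).flip (y k) x)]
      exact OType.le_dual.1 hxk
    · exact (holds_setNomT (hfresh k) (List.mem_cons_of_mem _ (List.mem_cons_of_mem _ hz))).2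
        (hx z (List.mem_cons_of_mem _ hz))

-- Derivation steps and first approximation

theorem Step.admValid_iff (he : IsCanonicalExtension e) (hA : IsSecondKind A) {q : QIneq}
    {S : Set QIneq} (h : Step e q S) : q.AdmValid e ↔ ∀ q' ∈ S, q'.AdmValid e := by
  cases h with
  | ord h => simpa using h.admValid_iff he
  | muApprox τ ψ φ i y Γ c hψ hφ _ hpres hfresh =>
    rw [Set.forall_mem_range]
    exact admValid_muApprox he hA hψ.2 hφ hpres hfresh
  | nuApprox τ φ ψ m y Γ c hφ hψ _ hpres hfresh =>
    rw [Set.forall_mem_range]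
    exact admValid_nuApprox he hA hφ.2 hψ hpres hfresh

theorem SetStep.admValid_iff (he : IsCanonicalExtension e) (hA : IsSecondKind A)
    {Q Q' : Set QIneq} (h : SetStep e Q Q') :
    (∀ q ∈ Q, q.AdmValid e) ↔ ∀ q ∈ Q', q.AdmValid e := by
  obtain ⟨q, hq, S, hS, rfl⟩ := h
  have hiff := hS.admValid_iff he hA
  constructor
  · rintro hQ q' (⟨hq', -⟩ | hq')
    · exact hQ q' hq'
    · exact hiff.1 (hQ q hq) q' hq'
  · intro hQ q' hq'
    by_cases h : q' = q
    · rw [h]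
      exact hiff.2 fun r hr => hQ r (Or.inr hr)
    · exact hQ q' (Or.inl ⟨hq', h⟩)

/-- An inequality in `C` can be tested on irreducibles below its left side and above its right side.
Formulas of `𝓛_*` contain no nominals or co-nominals, so `i` and `m` can be reassigned freely. -/
theorem admValid_firstApprox (he : IsCanonicalExtension e) (φ ψ : Term 0) (i m : ℕ) :
    (φ.star ≼ ψ.star).AdmValid e ↔ (firstApprox φ ψ i m).AdmValid e := by
  constructor
  · intro h V hV hx
    have h₁ := hx _ List.mem_cons_self
    have h₂ := hx _ (List.mem_cons_of_mem _ List.mem_cons_self)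
    exact (h₁.trans (h V hV)).trans h₂
  · intro h V hV
    refine he.le_of_forall_isCJI fun j hj hjφ => he.le_of_forall_isCMI fun n hn hψn => ?_
    have := h _ ((hV.setNom i hj).setConom m hn) (by
      simp only [firstApprox, List.forall_mem_cons, Ineq.Holds]
      refine ⟨?_, ?_, by simp⟩
      · rw [φ.eval_star_congr (V := (V.setNom i j).setConom m n) (W := V) rfl]
        simpa [XTerm.eval, Valuation.setNom, Valuation.setConom] using hjφ
      · rw [ψ.eval_star_congr (V := (V.setNom i j).setConom m n) (W := V) rfl]
        simpa [XTerm.eval, Valuation.setNom, Valuation.setConom] using hψn)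
    simpa [firstApprox, Ineq.Holds, XTerm.eval, Valuation.setNom, Valuation.setConom] using this

end Soundness

end MuALBA

theorem mainTheorem4 {A : Type u} [MuALBA.ModalBiheytingAlgebra A]
    {C : Type v} [CompletelyDistribLattice C]
    (e : BoundedLatticeHom A C) (he : MuALBA.IsCanonicalExtension e)
    (φ ψ : MuALBA.Term 0) (hφ : φ.WF) (hψ : ψ.WF) (i m : ℕ) :
    (MuALBA.IsSecondKind A →
      ∀ Q : Set MuALBA.QIneq, MuALBA.Derives e {MuALBA.firstApprox φ ψ i m} Q →
        (MuALBA.Ineq.AdmValid e (MuALBA.Ineq.mk φ.star ψ.star) ↔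
          ∀ q ∈ Q, MuALBA.QIneq.AdmValid e q)) ∧
    (MuALBA.IsFirstKind A →
      ∀ q : MuALBA.QIneq,
        Relation.ReflTransGen MuALBA.OrdStep (MuALBA.firstApprox φ ψ i m) q →
        (MuALBA.Ineq.AdmValid e (MuALBA.Ineq.mk φ.star ψ.star) ↔
          MuALBA.QIneq.AdmValid e q)) := by
  refine ⟨fun hA Q hQ => ?_, fun _ q hq => ?_⟩
  · rw [MuALBA.admValid_firstApprox he φ ψ i m]
    induction hQ with
    | refl => simp
    | tail _ h ih => exact ih.trans (h.admValid_iff he hA)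
  · rw [MuALBA.admValid_firstApprox he φ ψ i m]
    induction hq with
    | refl => rfl
    | tail _ h ih => exact ih.trans (h.admValid_iff he)
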